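/- **Theorem (Tableau formula for vexillary determinants).** Let $\tau=(p_\bullet,q_\bullet)$ be a complete triple of length $n$: integers (possibly negative) $p_1\le\dots\le p_n$ and $q_1\ge\dots\ge q_n$ such that $\lambda_i:=q_i-p_i+i$ satisfies $\lambda_1\ge\dots\ge\lambda_n>0$. Let $x_i,y_i$ ($i\in\mathbb Z$) be elements of a commutative ring (for instance independent variables), and put $\tilde x_i=-x_{1-i}$, $\tilde y_i=-y_{1-i}$ for $i\ge1$. Let $$a(i)=\frac{\prod_{j=p_i+1}^{0}(1-x_jt)\,\prod_{j=1}^{q_i}(1+y_jt)}{\prod_{j=1}^{p_i}(1-x_jt)\,\prod_{j=q_i+1}^{0}(1+y_jt)},\qquad S_{\lambda/\mu}(a(\bullet))=\det\bigl(a(k)_{\lambda_k-\mu_l+l-k}\bigr)_{1\le k,l\le n},$$ where $f_m$ is the coefficient of $t^m$ in $f$ (zero for $m<0$) and empty products are $1$. For a power series $c=1+c_1t+c_2t^2+\cdots$ let $S_\mu(c)=\det(c_{\mu_k+l-k})_{1\le k,l\le n}$, and let $P_\tau(c,x,y)=\det\bigl((a(k)\,c)_{\lambda_k+l-k}\bigr)_{1\le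 k,l\le n}$ be the vexillary enriched Schubert polynomial. *Divisions.* A division of $\tau$ consists of integers $0\le r<s\le n+1$ such that $p_i\le0\le q_i$ for $i\le r$, $q_i\le0\le p_i$ for $i\ge s$, and either (1) $p_i,q_i\ge0$ for all $r<i<s$, or (2) $p_i,q_i\le0$ for all $r<i<s$, together with a choice of a case, (1) or (2), that holds. Given a division, define nonnegative flags $(P_i,Q_i)$ to be $(0,\,q_i-p_i)$ for $i\le r$; $(p_i-q_i,\,0)$ for $i\ge s$; and for $r<i<s$, $(p_i,q_i)$ in case (1) and $(-q_i,-p_i)$ in case (2). *Tableaux.* For weakly decreasing integers $\mu_1\ge\dots\ge\mu_n$ with $\mu_i\le\lambda_i$, a tableau on $\lambda/\mu$ is a filling of the boxes $(i,j)$, $1\le i\le n$, $\mu_i<j\le\lambda_i$, each box containing a plain integer $k$, a primed integer $l'$, or a pair $(k,l')$, such that: - in row $i$, every $k$ satisfies $1\le k\le P_i$ and every $l'$ satisfies $1\le l\le Q_i$; - a box immediately right of or below a box containing a plain (resp. primed) entry contains a plain (resp. primed) entry; plain entries increase weakly along rows and strictly down columns; primed entries increase strictly along rows and weakly down columns; -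 the entry immediately right of a pair $(k,l')$ is $(k+m,(l+m+1)')$, and the entry immediately below it is $(k+m+1,(l+m)')$, for some $m\ge0$; - in box $(i,j)$, a pair $(k,l')$ has $l-k=j-i$, a lone plain $k$ has $k\le i-j$, and a lone primed $l'$ has $l\le j-i$. *Weights.* Give $k$, $l'$, $(k,l')$ the weights $u_k$, $v_l$, $u_k+v_l$, and a tableau the product of the weights of its entries, where $u$ and $v$ are specialized as follows. In case (1), the sequence $v_1,v_2,\dots$ is $y_1,\dots,y_{q_r},\ \tilde x_1,\dots,\tilde x_{-p_r},\ y_{q_r+1},\dots,y_{q_{r-1}},\ \tilde x_{-p_r+1},\dots,\tilde x_{-p_{r-1}},\ \dots$, through row $1$ (all $q_1-p_1$ variables), and $u_1,u_2,\dots$ is $x_1,\dots,x_{p_s},\ \tilde y_1,\dots,\tilde y_{-q_s},\ x_{p_s+1},\dots,x_{p_{s+1}},\ \tilde y_{-q_s+1},\dots,\tilde y_{-q_{s+1}},\ \dots$, through row $n$ (all $p_n-q_n$ variables); if $r=0$ then $v_l=y_l$ for all $l$, and if $s=n+1$ then $u_k=x_k$ for all $k$. In case (2) the roles are interchanged: each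 block of $\tilde x$'s precedes the corresponding block of $y$'s, each block of $\tilde y$'s precedes the corresponding block of $x$'s, and $v_l=\tilde x_l$ if $r=0$, $u_k=\tilde y_k$ if $s=n+1$. Then $\tau$ has a division, and for every division and every weakly decreasing integer sequence $\mu$ with $\mu_i\le\lambda_i$, $$S_{\lambda/\mu}(a(\bullet))=\sum_{T}\operatorname{wt}(T),$$ the sum over all tableaux $T$ on $\lambda/\mu$. The right side is a polynomial with nonnegative integer coefficients in the $x_i,y_i,\tilde x_i,\tilde y_i$, $i\ge1$. Consequently $$P_\tau(c,x,y)=\sum_{\mu\subset\lambda}\Bigl(\sum_{T\text{ on }\lambda/\mu}\operatorname{wt}(T)\Bigr)S_\mu(c),$$ the outer sum over all partitions $\mu\subset\lambda$. -/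

import Mathlib

namespace Vexillary

/-- A complete triple of length `n`: integer sequences `p` (weakly increasing) and `q` (weakly
decreasing), with `k_i = i`, such that the numbers `l_i = q_i - p_i + i` are weakly decreasing and
positive.  Rows are numbered from `1` to `n`; row number `i` is the element of `Fin n` with
value `i - 1`. -/
structure CompleteTriple (n : ℕ) where
  p : Fin n → ℤ
  q : Fin n → ℤ
  p_mono : Monotone p
  q_anti : Antitone q
  l_anti : Antitone fun i : Fin n => q i - p i + ((i : ℤ) + 1)
  l_pos : ∀ i : Fin n, 0 < q i - p i + ((i : ℤ) + 1)

/-- The partition of a complete triple: `λ_i = q_i - p_i + i`. -/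
def CompleteTriple.shape {n : ℕ} (τ : CompleteTriple n) (i : Fin n) : ℤ :=
  τ.q i - τ.p i + ((i : ℤ) + 1)

section Determinants

variable {R : Type*} [CommRing R]

/-- The coefficient of `t ^ m` for `m : ℤ`; it is zero for negative `m`. -/
noncomputable def intCoeff (f : PowerSeries R) (m : ℤ) : R :=
  if 0 ≤ m then PowerSeries.coeff m.toNat f else 0

/-- `S_{λ/μ}(f(1), …, f(n)) = det (f(k)_{λ_k - μ_l + l - k})`. -/
noncomputable def skewSchur {n : ℕ} (f : Fin n → PowerSeries R) (lam mu : Fin n → ℤ) : R :=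
  Matrix.det (Matrix.of fun k l : Fin n => intCoeff (f k) (lam k - mu l + (l : ℤ) - (k : ℤ)))

/-- `S_λ(f(1), …, f(n))`. -/
noncomputable def schur {n : ℕ} (f : Fin n → PowerSeries R) (lam : Fin n → ℤ) : R :=
  skewSchur f lam 0

/-- The numerator of `a(p, q)`: `∏_{i=p+1}^0 (1 - x_i t) * ∏_{j=1}^q (1 + y_j t)`. -/
noncomputable def chernNum (x y : ℤ → R) (p q : ℤ) : PowerSeries R :=
  (∏ i ∈ Finset.Icc (p + 1) 0, (1 - PowerSeries.C (x i) * PowerSeries.X)) *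
    ∏ j ∈ Finset.Icc 1 q, (1 + PowerSeries.C (y j) * PowerSeries.X)

/-- The denominator of `a(p, q)`: `∏_{i=1}^p (1 - x_i t) * ∏_{j=q+1}^0 (1 + y_j t)`. -/
noncomputable def chernDen (x y : ℤ → R) (p q : ℤ) : PowerSeries R :=
  (∏ i ∈ Finset.Icc 1 p, (1 - PowerSeries.C (x i) * PowerSeries.X)) *
    ∏ j ∈ Finset.Icc (q + 1) 0, (1 + PowerSeries.C (y j) * PowerSeries.X)

/-- The Chern series `a(p, q)`; the denominator has constant coefficient `1`, so `invOfUnit _ 1`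
is its inverse. -/
noncomputable def chernSeries (x y : ℤ → R) (p q : ℤ) : PowerSeries R :=
  chernNum x y p q * PowerSeries.invOfUnit (chernDen x y p q) 1

/-- The Chern series `a(i) = a(p_i, q_i)` of a complete triple. -/
noncomputable def CompleteTriple.chern {n : ℕ} (τ : CompleteTriple n) (x y : ℤ → R) (i : Fin n) :
    PowerSeries R :=
  chernSeries x y (τ.p i) (τ.q i)

/-- The vexillary enriched Schubert polynomial `P_τ(c, x, y) = S_λ(a(1) c, …, a(n) c)`. -/
noncomputable def CompleteTriple.enriched {n : ℕ} (τ : CompleteTriple n) (c : PowerSeries R)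
    (x y : ℤ → R) : R :=
  schur (fun i => τ.chern x y i * c) τ.shape

end Determinants

/-- The variables `x_k`, `y_k`, `x̃_k = -x_{1-k}`, `ỹ_k = -y_{1-k}`, for `k ≥ 1`. -/
inductive Letter where
  | x (k : ℕ)
  | y (k : ℕ)
  | xt (k : ℕ)
  | yt (k : ℕ)
  deriving DecidableEq

/-- The values of the letters, given the values of `x_i` and `y_j` for `i, j : ℤ`. -/
def letterValue {R : Type*} [CommRing R] (x y : ℤ → R) : Letter → R
  | .x k => x k
  | .y k => y k
  | .xt k => -x (1 - k)
  | .yt k => -y (1 - k)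

/-- The two cases for the middle rows `r < i < s`: all `p_i, q_i ≥ 0`, or all `p_i, q_i ≤ 0`. -/
inductive MiddleCase where
  | nonneg
  | nonpos
  deriving DecidableEq

/-- A division of the rows `1, …, n` into the rows `i ≤ r`, where `p_i ≤ 0 ≤ q_i`, the rows
`r < i < s`, where `p_i` and `q_i` are all nonnegative or all nonpositive, and the rows `i ≥ s`,
where `q_i ≤ 0 ≤ p_i`. -/
structure CompleteTriple.Division {n : ℕ} (τ : CompleteTriple n) where
  r : ℕ
  s : ℕ
  sign : MiddleCase
  r_lt_s : r < s
  s_le : s ≤ n + 1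
  upper : ∀ i : Fin n, (i : ℕ) + 1 ≤ r → τ.p i ≤ 0 ∧ 0 ≤ τ.q i
  lower : ∀ i : Fin n, s ≤ (i : ℕ) + 1 → 0 ≤ τ.p i ∧ τ.q i ≤ 0
  middle : ∀ i : Fin n, r < (i : ℕ) + 1 → (i : ℕ) + 1 < s →
    match sign with
    | .nonneg => 0 ≤ τ.p i ∧ 0 ≤ τ.q i
    | .nonpos => τ.p i ≤ 0 ∧ τ.q i ≤ 0

/-- For `(m_1, k_1), (m_2, k_2), …` with both coordinates weakly increasing, the word
`A_1 … A_{m_1}  B_1 … B_{k_1}  A_{m_1+1} … A_{m_2}  B_{k_1+1} … B_{k_2}  …`.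
The first two numbers count the letters `A` and `B` that are already in use. -/
def alternating (A B : ℕ → Letter) : ℕ → ℕ → List (ℕ × ℕ) → List Letter
  | _, _, [] => []
  | m, k, (m', k') :: L =>
    (List.range (m' - m)).map (fun t => A (m + t + 1)) ++
      (List.range (k' - k)).map (fun t => B (k + t + 1)) ++ alternating A B m' k' L

namespace CompleteTriple.Division

variable {n : ℕ} {τ : CompleteTriple n} (D : τ.Division)

/-- The upper bound on the plain entries in row `i` of a tableau. -/
def plainFlag (i : Fin n) : ℕ :=
  if (i : ℕ) + 1 ≤ D.r then 0
  else if D.s ≤ (i : ℕ) + 1 then (τ.p i - τ.q i).toNat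
  else match D.sign with
    | .nonneg => (τ.p i).toNat
    | .nonpos => (-τ.q i).toNat

/-- The upper bound on the primed entries in row `i` of a tableau. -/
def primedFlag (i : Fin n) : ℕ :=
  if (i : ℕ) + 1 ≤ D.r then (τ.q i - τ.p i).toNat
  else if D.s ≤ (i : ℕ) + 1 then 0
  else match D.sign with
    | .nonneg => (τ.q i).toNat
    | .nonpos => (-τ.p i).toNat

/-- The rows `r, r - 1, …, 1`, in this order. -/
def upperRows : List (Fin n) :=
  ((List.finRange n).filter fun i : Fin n => (i : ℕ) + 1 ≤ D.r).reverse

/-- The rows `s, s + 1, …, n`, in this order. -/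
def lowerRows : List (Fin n) :=
  (List.finRange n).filter fun i : Fin n => D.s ≤ (i : ℕ) + 1

/-- The letters substituted for `v_1, v_2, …, v_{q_1 - p_1}` by the rows `i ≤ r`. -/
def vWord : List Letter :=
  match D.sign with
  | .nonneg =>
    alternating .y .xt 0 0 (D.upperRows.map fun i => ((τ.q i).toNat, (-τ.p i).toNat))
  | .nonpos =>
    alternating .xt .y 0 0 (D.upperRows.map fun i => ((-τ.p i).toNat, (τ.q i).toNat))

/-- The letters substituted for `u_1, u_2, …, u_{p_n - q_n}` by the rows `i ≥ s`. -/
def uWord : List Letter :=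
  match D.sign with
  | .nonneg =>
    alternating .x .yt 0 0 (D.lowerRows.map fun i => ((τ.p i).toNat, (-τ.q i).toNat))
  | .nonpos =>
    alternating .yt .x 0 0 (D.lowerRows.map fun i => ((-τ.q i).toNat, (τ.p i).toNat))

/-- The letter substituted for `v_l`, `l ≥ 1`.  The default value, for `l` beyond the length of the
word, matters only if `r = 0`, and then it is the letter that the middle rows call for. -/
def vLetter (l : ℕ) : Letter :=
  D.vWord.getD (l - 1) (match D.sign with | .nonneg => .y l | .nonpos => .xt l)

/-- The letter substituted for `u_k`, `k ≥ 1`.  The default value, for `k` beyond the length of the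
word, matters only if `s = n + 1`, and then it is the letter that the middle rows call for. -/
def uLetter (k : ℕ) : Letter :=
  D.uWord.getD (k - 1) (match D.sign with | .nonneg => .x k | .nonpos => .yt k)

end CompleteTriple.Division

/-- An entry of a tableau: a plain integer `k`, a primed integer `l'`, or a pair `(k, l')`. -/
inductive Entry where
  | plain (k : ℕ)
  | primed (l : ℕ)
  | pair (k l : ℕ)
  deriving DecidableEq

/-- The plain integer contained in an entry, if any. -/
def Entry.plain? : Entry → Option ℕ
  | .plain k => some k
  | .primed _ => none
  | .pair k _ => some k

/-- The primed integer contained in an entry, if any. -/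
def Entry.primed? : Entry → Option ℕ
  | .plain _ => none
  | .primed l => some l
  | .pair _ l => some l

/-- The entries with plain integers in `[1, P]` and primed integers in `[1, Q]`. -/
def entries (P Q : ℕ) : Finset Entry :=
  (Finset.Icc 1 P).image .plain ∪ (Finset.Icc 1 Q).image .primed ∪
    (Finset.Icc 1 P ×ˢ Finset.Icc 1 Q).image fun kl => .pair kl.1 kl.2

/-- The boxes of the skew diagram `λ/μ`: pairs of a row `i` and a column `j` with
`μ_i < j ≤ λ_i`. -/
abbrev Box {n : ℕ} (lam mu : Fin n → ℤ) : Type :=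
  (i : Fin n) × {j : ℤ // j ∈ Finset.Ioc (mu i) (lam i)}

/-- The diagonal `j - i` of the box in row `i` and column `j` (rows numbered from `1`). -/
def Box.diag {n : ℕ} {lam mu : Fin n → ℤ} (b : Box lam mu) : ℤ :=
  b.2.1 - ((b.1 : ℤ) + 1)

/-- `b'` is the box immediately to the right of `b`. -/
def Box.IsRightOf {n : ℕ} {lam mu : Fin n → ℤ} (b' b : Box lam mu) : Prop :=
  b'.1 = b.1 ∧ b'.2.1 = b.2.1 + 1

/-- `b'` is the box immediately below `b`. -/
def Box.IsBelow {n : ℕ} {lam mu : Fin n → ℤ} (b' b : Box lam mu) : Prop :=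
  (b'.1 : ℕ) = (b.1 : ℕ) + 1 ∧ b'.2.1 = b.2.1

/-- Compatibility of an entry `e` with the entry `f` to its right: if `e` contains a plain integer,
so does `f`, and plain integers increase weakly; if `e` contains a primed integer, so does `f`, and
primed integers increase strictly; a pair `(k, l')` is followed by some `(k + m, (l + m + 1)')`. -/
def RowRule (e f : Entry) : Prop :=
  (∀ k, e.plain? = some k → ∃ k', f.plain? = some k' ∧ k ≤ k') ∧
  (∀ l, e.primed? = some l → ∃ l', f.primed? = some l' ∧ l < l') ∧
  (∀ k l, e = .pair k l → ∃ m, f = .pair (k + m) (l + m + 1))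

/-- Compatibility of an entry `e` with the entry `f` below it: if `e` contains a plain integer,
so does `f`, and plain integers increase strictly; if `e` contains a primed integer, so does `f`,
and primed integers increase weakly; below a pair `(k, l')` is some `(k + m + 1, (l + m)')`. -/
def ColumnRule (e f : Entry) : Prop :=
  (∀ k, e.plain? = some k → ∃ k', f.plain? = some k' ∧ k < k') ∧
  (∀ l, e.primed? = some l → ∃ l', f.primed? = some l' ∧ l ≤ l') ∧
  (∀ k l, e = .pair k l → ∃ m, f = .pair (k + m + 1) (l + m))

/-- Compatibility of an entry with the diagonal `d` of its box.  The admissible entries come from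
integers `k` and `l = k + d`, by keeping those of `k`, `l'` that are positive. -/
def DiagonalRule (d : ℤ) : Entry → Prop
  | .plain k => (k : ℤ) ≤ -d
  | .primed l => (l : ℤ) ≤ d
  | .pair k l => (l : ℤ) - k = d

open Classical in
/-- The tableaux on `λ/μ` with flags `P`, `Q`. -/
noncomputable def tableaux {n : ℕ} (lam mu : Fin n → ℤ) (P Q : Fin n → ℕ) :
    Finset (Box lam mu → Entry) :=
  (Fintype.piFinset fun b : Box lam mu => entries (P b.1) (Q b.1)).filter fun T =>
    (∀ b b' : Box lam mu, b'.IsRightOf b → RowRule (T b) (T b')) ∧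
    (∀ b b' : Box lam mu, b'.IsBelow b → ColumnRule (T b) (T b')) ∧
    ∀ b : Box lam mu, DiagonalRule b.diag (T b)

namespace CompleteTriple.Division

variable {n : ℕ} {τ : CompleteTriple n} (D : τ.Division)

/-- The weight of an entry after the substitution: `u_k` for `k`, `v_l` for `l'`, and `u_k + v_l`
for `(k, l')`; a polynomial with coefficients in `ℕ` in the variables `x_k, y_k, x̃_k, ỹ_k`. -/
noncomputable def entryWeight : Entry → MvPolynomial Letter ℕ
  | .plain k => MvPolynomial.X (D.uLetter k)
  | .primed l => MvPolynomial.X (D.vLetter l)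
  | .pair k l => MvPolynomial.X (D.uLetter k) + MvPolynomial.X (D.vLetter l)

/-- The sum of the weights of all tableaux on `λ/μ`. -/
noncomputable def tableauSum (mu : Fin n → ℤ) : MvPolynomial Letter ℕ :=
  ∑ T ∈ tableaux τ.shape mu D.plainFlag D.primedFlag, ∏ b, D.entryWeight (T b)

end CompleteTriple.Division

open Classical in
/-- The partitions `μ ⊂ λ` of length at most `n`, as sequences of length `n`. -/
noncomputable def subpartitions {n : ℕ} (lam : Fin n → ℤ) : Finset (Fin n → ℤ) :=
  (Fintype.piFinset fun i => Finset.Icc 0 (lam i)).filter fun mu => Antitone mu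

end Vexillary
/-!
Record a box of the skew shape by its row `i` and its diagonal `d`, and encode its entry by a single
integer `k` that stands for those of the plain entry `k` and the primed entry `(k + d)'` that are
positive.  Since `Q_i - P_i = λ_i - i` is the last diagonal of row `i`, the rules for tableaux then
say only that `k` increases weakly along rows and strictly down columns and is at most `P_i`, and
the weight of the box is `u_k + v_{k+d}`, with `u` and `v` extended by zero.

The generating series `∏_{l ≤ P + b} (1 + v_l t) / ∏_{k ≤ P} (1 - u_k t)` of a row ending on the
diagonal `b` is the sum of the one with `P` lowered by one and of `(u_P + v_{P+b}) t` times the one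
with `b` lowered by one.  In the first row whose flag `P` is maximal, this matches the alternative
whether or not the last box contains `P`, so the sum over tableaux and the Jacobi–Trudi determinant
satisfy the same recursion.  If that row is empty, or if the next row ends directly below it, no
tableau has `P` in the last box, and the determinant with `b` lowered vanishes too: it has a block
of zeros or two equal rows.  Negative flags are allowed, so the recursion continues until the flags
leave no entry for any box.

For a division, the first `P_i` letters of `u` and the first `Q_i` letters of `v` are, up to order,
the variables in the denominator and the numerator of `a(i)`.  The expansion of `P_τ` is the
Cauchy–Binet formula for the determinant of the coefficients of `a(k) c`.
-/

namespace Vexillary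

section Determinants

variable {R : Type*} [CommRing R]

theorem det_of_sum_mul {m α : Type*} [Fintype m] [DecidableEq m] (Z : Finset α) (A : m → α → R)
    (B : α → m → R) :
    (Matrix.of fun k l => ∑ z ∈ Z, A k z * B z l).det =
      ∑ f ∈ Fintype.piFinset fun _ : m => Z,
        (∏ k, A k (f k)) * (Matrix.of fun k => B (f k)).det := by
  have hrows : (Matrix.of fun k l => ∑ z ∈ Z, A k z * B z l) = fun k => ∑ z ∈ Z, A k z • B z := by
    ext k l
    simp only [Matrix.of_apply, Finset.sum_apply, Pi.smul_apply, smul_eq_mul]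
  rw [hrows]
  refine (Matrix.detRowAlternating.toMultilinearMap.map_sum_finset
    (fun k z => A k z • B z) fun _ => Z).trans (Finset.sum_congr rfl fun f _ => ?_)
  exact Matrix.detRowAlternating.toMultilinearMap.map_smul_univ _ _

theorem det_mul_det_eq_sum_perm {m : Type*} [Fintype m] [DecidableEq m] (M N : Matrix m m R) :
    M.det * N.det = ∑ σ : Equiv.Perm m, (∏ k, M k (σ k)) * (N.submatrix σ id).det := by
  rw [← M.det_transpose, Matrix.det_apply', Finset.sum_mul]
  refine Finset.sum_congr rfl fun σ _ => ?_
  rw [Matrix.det_permute]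
  simp only [Matrix.transpose_apply]
  ring

variable {n : ℕ} {α : Type*} [LinearOrder α]

theorem strictAnti_comp_perm_inj {g g' : Fin n → α} {σ σ' : Equiv.Perm (Fin n)}
    (hg : StrictAnti g) (hg' : StrictAnti g') (h : g ∘ σ = g' ∘ σ') : g = g' ∧ σ = σ' := by
  have hgg' : g = g' := by
    have hσ : (g ∘ σ) ∘ σ.symm = g := by ext; simp
    have hσ' : (g ∘ σ) ∘ σ'.symm = g' := by rw [h]; ext; simp
    rw [← hσ, ← hσ']
    exact Tuple.unique_antitone (hσ.symm ▸ hg.antitone) (hσ'.symm ▸ hg'.antitone)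
  subst hgg'
  exact ⟨rfl, Equiv.ext fun k => hg.injective (congrFun h k)⟩

theorem exists_strictAnti_comp_perm {f : Fin n → α} (hf : Function.Injective f) :
    ∃ g : Fin n → α, StrictAnti g ∧ ∃ σ : Equiv.Perm (Fin n), g ∘ σ = f := by
  let σ := Tuple.sort (OrderDual.toDual ∘ f)
  have hanti : Antitone (f ∘ σ) := fun _ _ h => Tuple.monotone_sort (OrderDual.toDual ∘ f) h
  exact ⟨f ∘ σ, hanti.strictAnti_of_injective (hf.comp σ.injective), σ.symm, by ext; simp⟩

theorem sum_injective_eq_sum_strictAnti_perm {M : Type*} [AddCommMonoid M] (Z : Finset α)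
    (F : (Fin n → α) → M) :
    ∑ f ∈ (Fintype.piFinset fun _ : Fin n => Z) with Function.Injective f, F f =
      ∑ g ∈ (Fintype.piFinset fun _ : Fin n => Z) with StrictAnti g,
        ∑ σ : Equiv.Perm (Fin n), F (g ∘ σ) := by
  rw [← Finset.sum_product']
  symm
  refine Finset.sum_bij (fun gσ _ => gσ.1 ∘ gσ.2) ?_ ?_ ?_ fun _ _ => rfl
  · rintro ⟨g, σ⟩ h
    simp only [Finset.mem_product, Finset.mem_filter, Fintype.mem_piFinset] at h ⊢
    exact ⟨fun k => h.1.1 (σ k), h.1.2.injective.comp σ.injective⟩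
  · rintro ⟨g, σ⟩ h ⟨g', σ'⟩ h' heq
    simp only [Finset.mem_product, Finset.mem_filter] at h h'
    exact Prod.ext_iff.2 (strictAnti_comp_perm_inj h.1.2 h'.1.2 heq)
  · intro f hf
    simp only [Finset.mem_filter, Fintype.mem_piFinset] at hf
    obtain ⟨g, hg, σ, rfl⟩ := exists_strictAnti_comp_perm hf.2
    refine ⟨(g, σ), ?_, rfl⟩
    simp only [Finset.mem_product, Finset.mem_filter, Fintype.mem_piFinset, Finset.mem_univ,
      and_true]
    exact ⟨fun k => by simpa using hf.1 (σ.symm k), hg⟩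

theorem cauchy_binet (Z : Finset α) (A : Fin n → α → R) (B : α → Fin n → R) :
    (Matrix.of fun k l => ∑ z ∈ Z, A k z * B z l).det =
      ∑ g ∈ (Fintype.piFinset fun _ : Fin n => Z) with StrictAnti g,
        (Matrix.of fun k j => A k (g j)).det * (Matrix.of fun j => B (g j)).det := by
  have hinj : ∀ f ∈ Fintype.piFinset fun _ : Fin n => Z,
      (∏ k, A k (f k)) * (Matrix.of fun k => B (f k)).det ≠ 0 → Function.Injective f := by
    intro f _ hne k l hkl
    by_contra hne'
    exact hne (mul_eq_zero_of_right _ (Matrix.det_zero_of_row_eq hne' (congrArg B hkl)))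
  rw [det_of_sum_mul, ← Finset.sum_filter_of_ne hinj, sum_injective_eq_sum_strictAnti_perm]
  refine Finset.sum_congr rfl fun g _ => ?_
  rw [det_mul_det_eq_sum_perm]
  rfl

theorem det_eq_zero_of_forall_le {m : Type*} [Fintype m] [LinearOrder m] {M : Matrix m m R} (i : m)
    (h : ∀ k l, i ≤ k → l ≤ i → M k l = 0) : M.det = 0 := by
  rw [Matrix.det_apply']
  refine Finset.sum_eq_zero fun σ _ => ?_
  have hσ : ∃ j ≤ i, i ≤ σ j := by
    by_contra! hlt
    have hcard : (Finset.univ.filter (· ≤ i)).card ≤ (Finset.univ.filter (· < i)).card :=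
      Finset.card_le_card_of_injOn σ (fun j hj => by simpa using hlt j (by simpa using hj))
        σ.injective.injOn
    refine hcard.not_gt (Finset.card_lt_card (Finset.ssubset_iff_subset_ne.2 ⟨?_, fun heq => ?_⟩))
    · exact Finset.monotone_filter_right _ fun _ _ => le_of_lt
    · simpa using heq.ge (Finset.mem_filter.2 ⟨Finset.mem_univ i, le_rfl⟩)
  obtain ⟨j, hji, hij⟩ := hσ
  exact mul_eq_zero_of_right _ (Finset.prod_eq_zero (Finset.mem_univ j) (h _ _ hij hji))

end Determinants

section Series

open PowerSeries

variable {R : Type*} [CommRing R]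

theorem intCoeff_of_neg (f : PowerSeries R) {m : ℤ} (h : m < 0) : intCoeff f m = 0 :=
  if_neg h.not_ge

theorem intCoeff_natCast (f : PowerSeries R) (m : ℕ) : intCoeff f m = coeff m f := by
  simp [intCoeff]

theorem intCoeff_add (f g : PowerSeries R) (m : ℤ) :
    intCoeff (f + g) m = intCoeff f m + intCoeff g m := by
  unfold intCoeff
  split_ifs <;> simp

theorem intCoeff_one (m : ℤ) : intCoeff (1 : PowerSeries R) m = if m = 0 then 1 else 0 := by
  rcases lt_or_ge m 0 with h | h
  · rw [intCoeff_of_neg _ h, if_neg h.ne]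
  · lift m to ℕ using h
    simp [intCoeff_natCast, coeff_one]

theorem intCoeff_C_mul_X_mul (c : R) (f : PowerSeries R) (m : ℤ) :
    intCoeff (C c * X * f) m = c * intCoeff f (m - 1) := by
  rcases lt_or_ge m 0 with h | h
  · rw [intCoeff_of_neg _ h, intCoeff_of_neg _ (by omega), mul_zero]
  · lift m to ℕ using h
    rw [mul_assoc, intCoeff_natCast, coeff_C_mul]
    cases m with
    | zero => simp [intCoeff_of_neg]
    | succ m =>
      rw [coeff_succ_X_mul, ← intCoeff_natCast]
      congr 2
      push_cast
      ring

theorem intCoeff_mul_eq_sum_Icc (f g : PowerSeries R) (s t : ℤ) :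
    intCoeff (f * g) (s - t) = ∑ z ∈ Finset.Icc t s, intCoeff f (s - z) * intCoeff g (z - t) := by
  rcases lt_or_ge s t with h | h
  · rw [intCoeff_of_neg _ (by omega), Finset.Icc_eq_empty (by omega), Finset.sum_empty]
  · obtain ⟨m, rfl⟩ := Int.le.dest h
    rw [show t + m - t = (m : ℤ) by ring, intCoeff_natCast, coeff_mul]
    refine Finset.sum_bij' (fun kl _ => t + kl.2) (fun z _ => ((t + m - z).toNat, (z - t).toNat))
      ?_ ?_ ?_ ?_ fun kl hkl => ?_
    · simp only [Finset.HasAntidiagonal.mem_antidiagonal, Finset.mem_Icc]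
      omega
    · simp only [Finset.HasAntidiagonal.mem_antidiagonal, Finset.mem_Icc]
      omega
    · simp only [Finset.HasAntidiagonal.mem_antidiagonal, Prod.ext_iff]
      omega
    · simp only [Finset.mem_Icc]
      omega
    · rw [Finset.HasAntidiagonal.mem_antidiagonal] at hkl
      rw [← intCoeff_natCast, ← intCoeff_natCast]
      congr 2 <;> omega

theorem intCoeff_mul (f g : PowerSeries R) {s t A B : ℤ} (hA : A ≤ t) (hB : s ≤ B) :
    intCoeff (f * g) (s - t) = ∑ z ∈ Finset.Icc A B, intCoeff f (s - z) * intCoeff g (z - t) := by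
  rw [intCoeff_mul_eq_sum_Icc]
  refine Finset.sum_subset (Finset.Icc_subset_Icc hA hB) fun z _ hz => ?_
  rw [Finset.mem_Icc, not_and_or] at hz
  rcases hz with hz | hz
  · rw [intCoeff_of_neg g (by omega), mul_zero]
  · rw [intCoeff_of_neg f (by omega), zero_mul]

/-- The series `∏_{l=1}^Q (1 + v_l t) / ∏_{k=1}^P (1 - u_k t)`, whose coefficients are the double
complete symmetric functions with flags `P` and `Q`. -/
noncomputable def flagSeries (u v : ℤ → R) (P Q : ℤ) : PowerSeries R :=
  (∏ l ∈ Finset.Icc 1 Q, (1 + C (v l) * X)) *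
    invOfUnit (∏ k ∈ Finset.Icc 1 P, (1 - C (u k) * X)) 1

theorem eq_mul_invOfUnit_iff {f g h : PowerSeries R} (hh : constantCoeff h = 1) :
    f = g * invOfUnit h 1 ↔ f * h = g := by
  have hinv : h * invOfUnit h 1 = 1 := mul_invOfUnit h 1 (by simpa using hh)
  constructor
  · rintro rfl
    rw [mul_assoc, mul_comm (invOfUnit h 1), hinv, mul_one]
  · rintro rfl
    rw [mul_assoc, hinv, mul_one]

theorem constantCoeff_prod_one_sub {α : Type*} (s : Finset α) (u : α → R) :
    constantCoeff (∏ k ∈ s, (1 - C (u k) * X)) = 1 := by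
  simp [map_prod]

theorem flagSeries_mul_prod (u v : ℤ → R) (P Q : ℤ) :
    flagSeries u v P Q * ∏ k ∈ Finset.Icc 1 P, (1 - C (u k) * X) =
      ∏ l ∈ Finset.Icc 1 Q, (1 + C (v l) * X) :=
  (eq_mul_invOfUnit_iff (constantCoeff_prod_one_sub _ u)).1 rfl

theorem prod_Icc_one_eq_mul {M : Type*} [CommMonoid M] {g : ℤ → M} (hg : ∀ k ≤ 0, g k = 1) (P : ℤ) :
    ∏ k ∈ Finset.Icc 1 P, g k = (∏ k ∈ Finset.Icc 1 (P - 1), g k) * g P := by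
  rcases le_or_gt P 0 with h | h
  · rw [Finset.Icc_eq_empty (by omega), Finset.Icc_eq_empty (by omega), hg P h, mul_one]
  · rw [mul_comm, ← Finset.prod_insert (by simp)]
    congr 1
    ext k
    simp only [Finset.mem_Icc, Finset.mem_insert]
    omega

theorem flagSeries_eq_add {u v : ℤ → R} (hu : ∀ k ≤ 0, u k = 0) (hv : ∀ k ≤ 0, v k = 0) (P Q : ℤ) :
    flagSeries u v P Q =
      flagSeries u v (P - 1) (Q - 1) + C (u P + v Q) * X * flagSeries u v P (Q - 1) := by
  have hnum : ∏ l ∈ Finset.Icc 1 Q, (1 + C (v l) * X) =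
      (∏ l ∈ Finset.Icc 1 (Q - 1), (1 + C (v l) * X)) * (1 + C (v Q) * X) :=
    prod_Icc_one_eq_mul (fun k hk => by simp [hv k hk]) Q
  have hden : ∏ k ∈ Finset.Icc 1 P, (1 - C (u k) * X) =
      (∏ k ∈ Finset.Icc 1 (P - 1), (1 - C (u k) * X)) * (1 - C (u P) * X) :=
    prod_Icc_one_eq_mul (fun k hk => by simp [hu k hk]) P
  have hP := flagSeries_mul_prod u v P (Q - 1)
  have hP' := flagSeries_mul_prod u v (P - 1) (Q - 1)
  refine ((eq_mul_invOfUnit_iff (constantCoeff_prod_one_sub _ u)).2 ?_).symm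
  rw [add_mul, mul_assoc _ (flagSeries u v P _), hP, hden, hnum, ← mul_assoc, hP', map_add]
  ring

/-- The coefficient of `t ^ (b - a)` in `flagSeries u v P (P + b)`: the generating function of the
lattice paths from `a` to `b` that end at height `P`, where a step to `d` at height `k` has weight
`u_k + v_{k+d}`. -/
noncomputable def flagCoeff (u v : ℤ → R) (P b a : ℤ) : R :=
  intCoeff (flagSeries u v P (P + b)) (b - a)

theorem flagCoeff_eq_add {u v : ℤ → R} (hu : ∀ k ≤ 0, u k = 0) (hv : ∀ k ≤ 0, v k = 0)
    (P b a : ℤ) :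
    flagCoeff u v P b a =
      flagCoeff u v (P - 1) b a + (u P + v (P + b)) * flagCoeff u v P (b - 1) a := by
  unfold flagCoeff
  rw [flagSeries_eq_add hu hv, intCoeff_add, intCoeff_C_mul_X_mul]
  congr 3 <;> ring_nf

theorem flagCoeff_of_nonpos (u v : ℤ → R) {P b : ℤ} (a : ℤ) (hP : P ≤ 0) (hPb : P + b ≤ 0) :
    flagCoeff u v P b a = if b = a then 1 else 0 := by
  have hone : flagSeries u v P (P + b) = 1 := by
    simpa [Finset.Icc_eq_empty (show ¬ 1 ≤ P by omega),
      Finset.Icc_eq_empty (show ¬ 1 ≤ P + b by omega)] using flagSeries_mul_prod u v P (P + b)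
  rw [flagCoeff, hone, intCoeff_one]
  simp only [sub_eq_zero]

theorem flagCoeff_of_lt (u v : ℤ → R) (P : ℤ) {a b : ℤ} (h : b < a) : flagCoeff u v P b a = 0 :=
  intCoeff_of_neg _ (by omega)

end Series

section LowerAt

variable {ι : Type*} [DecidableEq ι]

/-- The integer sequence `g` with its value at `i` lowered by one. -/
def lowerAt (g : ι → ℤ) (i : ι) : ι → ℤ :=
  Function.update g i (g i - 1)

theorem lowerAt_apply (g : ι → ℤ) (i j : ι) :
    lowerAt g i j = if j = i then g i - 1 else g j :=
  Function.update_apply ..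

theorem lowerAt_self (g : ι → ℤ) (i : ι) : lowerAt g i i = g i - 1 :=
  Function.update_self ..

theorem lowerAt_of_ne (g : ι → ℤ) {i j : ι} (h : j ≠ i) : lowerAt g i j = g j :=
  Function.update_of_ne h ..

theorem le_lowerAt {g c : ι → ℤ} {i : ι} (hle : c ≤ g) (hi : c i < g i) : c ≤ lowerAt g i := by
  intro j
  have := hle j
  grind [lowerAt_apply]

theorem lowerAt_le (g : ι → ℤ) (i : ι) : lowerAt g i ≤ g := by
  intro j
  grind [lowerAt_apply]

theorem sum_toNat_lowerAt_sub_lt [Fintype ι] {g c : ι → ℤ} {i : ι} (hi : c i < g i) :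
    ∑ j, (lowerAt g i j - c j).toNat < ∑ j, (g j - c j).toNat := by
  refine Finset.sum_lt_sum (fun j _ => ?_) ⟨i, Finset.mem_univ i, ?_⟩
  · have : lowerAt g i j ≤ g j := lowerAt_le g i j
    omega
  · rw [lowerAt_self]
    omega

end LowerAt

theorem monotone_lowerAt {ι : Type*} [LinearOrder ι] {g : ι → ℤ} {i : ι} (hg : Monotone g)
    (hi : ∀ j < i, g j < g i) : Monotone (lowerAt g i) := by
  intro j k hjk
  have := hg hjk
  grind [lowerAt_apply]

theorem strictAnti_lowerAt {ι : Type*} [LinearOrder ι] {g : ι → ℤ} {i : ι} (hg : StrictAnti g)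
    (hi : ∀ j > i, g j < g i - 1) : StrictAnti (lowerAt g i) := by
  intro j k hjk
  have := hg hjk
  grind [lowerAt_apply]

theorem eq_sub_one_and_covBy {ι : Type*} [LinearOrder ι] {g : ι → ℤ} {i j : ι} (hg : StrictAnti g)
    (hij : i < j) (hj : g i - 1 ≤ g j) : g j = g i - 1 ∧ i ⋖ j := by
  have hlt := hg hij
  refine ⟨by omega, hij, fun k hik hkj => ?_⟩
  have hki := hg hik
  have hjk := hg hkj
  omega

theorem exists_first_max {ι α : Type*} [LinearOrder ι] [Finite ι] [Nonempty ι] [LinearOrder α]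
    (P : ι → α) : ∃ i, (∀ j, P j ≤ P i) ∧ ∀ j < i, P j < P i := by
  obtain ⟨m, hm⟩ := Finite.exists_max P
  obtain ⟨i, hi, hmin⟩ := wellFounded_lt.has_min {i | P i = P m} ⟨m, rfl⟩
  rw [Set.mem_ofPred_eq] at hi
  exact ⟨i, hi ▸ hm, fun j hj => hi ▸ (hm j).lt_of_ne fun h => hmin j h hj⟩

section Fillings

variable {ι : Type*} [LinearOrder ι]

/-- The tableaux on a skew shape in diagonal coordinates: row `i` consists of the boxes on the
diagonals `a i < d ≤ b i`, and the box below `(i, d)` is `(i', d - 1)` for the next row `i'`.  The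
number `k` in `(i, d)` stands for the plain entry `k` and the primed entry `(k + d)'`, as far as
they are positive.  The value off the diagram is `0`. -/
structure IsFilling (a b P : ι → ℤ) (f : ι → ℤ → ℤ) : Prop where
  eq_zero : ∀ i, ∀ d ∉ Set.Ioc (a i) (b i), f i d = 0
  pos : ∀ i, ∀ d ∈ Set.Ioc (a i) (b i), 0 < f i d ∨ 0 < f i d + d
  le_flag : ∀ i, ∀ d ∈ Set.Ioc (a i) (b i), f i d ≤ P i
  row_mono : ∀ i, MonotoneOn (f i) (Set.Ioc (a i) (b i))
  col_lt : ∀ i i', i ⋖ i' → ∀ d ∈ Set.Ioc (a i) (b i), d - 1 ∈ Set.Ioc (a i') (b i') →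
    f i d < f i' (d - 1)

theorem finite_setOf_isFilling [Finite ι] (a b P : ι → ℤ) : {f | IsFilling a b P f}.Finite := by
  have hbox : {g : ((i : ι) × Set.Ioc (a i) (b i)) → ℤ |
      ∀ x, g x ∈ Set.Icc (min 1 (1 - x.2.1)) (P x.1)}.Finite :=
    Set.Finite.pi' fun _ => Set.finite_Icc _ _
  refine Set.Finite.of_injOn (f := fun f x => f x.1 x.2.1) ?_ ?_ hbox
  · rintro f hf ⟨i, d, hd⟩
    have := hf.pos i d hd
    exact ⟨by simp only; omega, hf.le_flag i d hd⟩
  · intro f hf g hg hfg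
    ext i d
    by_cases hd : d ∈ Set.Ioc (a i) (b i)
    · exact congrFun hfg ⟨i, d, hd⟩
    · rw [hf.eq_zero i d hd, hg.eq_zero i d hd]

theorem IsFilling.iff_eq_of_nonpos {a b P : ι → ℤ} {f : ι → ℤ → ℤ} (hP : ∀ i, P i ≤ 0)
    (hPb : ∀ i, P i + b i ≤ 0) : IsFilling a b P f ↔ f = 0 ∧ b ≤ a := by
  constructor
  · intro hf
    have hba : b ≤ a := by
      intro i
      by_contra! hi
      have hpos := hf.pos i _ ⟨hi, le_rfl⟩
      have hle := hf.le_flag i _ ⟨hi, le_rfl⟩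
      have := hP i
      have := hPb i
      omega
    refine ⟨?_, hba⟩
    ext i d
    exact hf.eq_zero i d (by simp [Set.Ioc_eq_empty (hba i).not_gt])
  · rintro ⟨rfl, hba⟩
    have hempty : ∀ i, Set.Ioc (a i) (b i) = ∅ := fun i => Set.Ioc_eq_empty (hba i).not_gt
    constructor <;> simp [hempty, MonotoneOn]

theorem isFilling_lowerAt_flag_iff {a b P : ι → ℤ} {i : ι} (hi : a i < b i) {f : ι → ℤ → ℤ} :
    IsFilling a b (lowerAt P i) f ↔ IsFilling a b P f ∧ f i (b i) ≠ P i := by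
  constructor
  · intro h
    refine ⟨⟨h.eq_zero, h.pos, fun j d hd => (h.le_flag j d hd).trans (lowerAt_le P i j),
      h.row_mono, h.col_lt⟩, fun heq => ?_⟩
    have := h.le_flag i (b i) ⟨hi, le_rfl⟩
    rw [lowerAt_self] at this
    omega
  · rintro ⟨h, hne⟩
    refine ⟨h.eq_zero, h.pos, fun j d hd => ?_, h.row_mono, h.col_lt⟩
    rcases eq_or_ne j i with rfl | hj
    · have hlast := h.le_flag j (b j) ⟨hi, le_rfl⟩
      have hrow := h.row_mono j hd ⟨hi, le_rfl⟩ hd.2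
      rw [lowerAt_self]
      omega
    · rw [lowerAt_of_ne P hj]
      exact h.le_flag j d hd

theorem isFilling_lowerAt_flag_iff_of_eq {a b P : ι → ℤ} {i : ι} (hi : b i = a i)
    {f : ι → ℤ → ℤ} : IsFilling a b (lowerAt P i) f ↔ IsFilling a b P f := by
  have hflag : ∀ j, ∀ d ∈ Set.Ioc (a j) (b j), lowerAt P i j = P j := by
    intro j d hd
    refine lowerAt_of_ne P ?_
    rintro rfl
    simp [hi] at hd
  constructor <;> intro h
  · exact ⟨h.eq_zero, h.pos, fun j d hd => hflag j d hd ▸ h.le_flag j d hd, h.row_mono, h.col_lt⟩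
  · exact ⟨h.eq_zero, h.pos, fun j d hd => hflag j d hd ▸ h.le_flag j d hd, h.row_mono, h.col_lt⟩

theorem IsFilling.last_ne_of_covBy {a b P : ι → ℤ} {f : ι → ℤ → ℤ} (h : IsFilling a b P f)
    (ha : StrictAnti a) {i i' : ι} (hi : a i < b i) (hii' : i ⋖ i') (hb : b i' = b i - 1)
    (hP : P i' ≤ P i) : f i (b i) ≠ P i := by
  have hbelow : b i - 1 ∈ Set.Ioc (a i') (b i') := by
    have := ha hii'.lt
    constructor <;> omega
  have hcol := h.col_lt i i' hii' (b i) ⟨hi, le_rfl⟩ hbelow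
  have hle := h.le_flag i' _ hbelow
  omega

/-- The filling `f` with the value `k` in the box `(i, d)`. -/
def setBox (f : ι → ℤ → ℤ) (i : ι) (d k : ℤ) : ι → ℤ → ℤ :=
  Function.update f i (Function.update (f i) d k)

theorem setBox_apply (f : ι → ℤ → ℤ) (i j : ι) (d e k : ℤ) :
    setBox f i d k j e = if j = i ∧ e = d then k else f j e := by
  rcases eq_or_ne j i with rfl | h
  · simp [setBox, Function.update_apply]
  · simp [setBox, h]

theorem setBox_self (f : ι → ℤ → ℤ) (i : ι) (d k : ℤ) : setBox f i d k i d = k := by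
  rw [setBox_apply, if_pos ⟨rfl, rfl⟩]

theorem setBox_of_ne (f : ι → ℤ → ℤ) {i j : ι} {d e : ℤ} (k : ℤ) (h : ¬ (j = i ∧ e = d)) :
    setBox f i d k j e = f j e := by
  rw [setBox_apply, if_neg h]

theorem setBox_setBox_of_eq {f : ι → ℤ → ℤ} {i : ι} {d k : ℤ} (k' : ℤ) (h : f i d = k) :
    setBox (setBox f i d k') i d k = f := by
  ext j e
  grind [setBox_apply]

theorem mem_Ioc_lowerAt_iff {a b : ι → ℤ} {i j : ι} {d : ℤ} :
    d ∈ Set.Ioc (a j) (lowerAt b i j) ↔ d ∈ Set.Ioc (a j) (b j) ∧ ¬ (j = i ∧ d = b i) := by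
  grind [lowerAt_apply]

theorem IsFilling.eraseLast {a b P : ι → ℤ} {f : ι → ℤ → ℤ} (h : IsFilling a b P f) (i : ι) :
    IsFilling a (lowerAt b i) P (setBox f i (b i) 0) := by
  have hset : ∀ j d, d ∈ Set.Ioc (a j) (lowerAt b i j) → setBox f i (b i) 0 j d = f j d :=
    fun j d hd => setBox_of_ne f 0 (mem_Ioc_lowerAt_iff.1 hd).2
  have hmem : ∀ j d, d ∈ Set.Ioc (a j) (lowerAt b i j) → d ∈ Set.Ioc (a j) (b j) :=
    fun j d hd => (mem_Ioc_lowerAt_iff.1 hd).1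
  constructor
  · intro j d hd
    by_cases hbox : j = i ∧ d = b i
    · rw [hbox.1, hbox.2, setBox_self]
    · rw [setBox_of_ne f 0 hbox]
      exact h.eq_zero j d fun hd' => hd (mem_Ioc_lowerAt_iff.2 ⟨hd', hbox⟩)
  · intro j d hd
    rw [hset j d hd]
    exact h.pos j d (hmem j d hd)
  · intro j d hd
    rw [hset j d hd]
    exact h.le_flag j d (hmem j d hd)
  · intro j d hd e he hde
    rw [hset j d hd, hset j e he]
    exact h.row_mono j (hmem j d hd) (hmem j e he) hde
  · intro j j' hjj' d hd hd'
    rw [hset j d hd, hset j' _ hd']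
    exact h.col_lt j j' hjj' d (hmem j d hd) (hmem j' _ hd')

theorem IsFilling.insertLast {a b P : ι → ℤ} {f : ι → ℤ → ℤ} {i : ι}
    (h : IsFilling a (lowerAt b i) P f) (hi : a i < b i) (hpos : 0 < P i ∨ 0 < P i + b i)
    (hmax : ∀ j < i, P j < P i) (hcorner : ∀ j > i, b j < b i - 1) :
    IsFilling a b P (setBox f i (b i) (P i)) := by
  have hset : ∀ {j d}, ¬ (j = i ∧ d = b i) → setBox f i (b i) (P i) j d = f j d :=
    setBox_of_ne f (P i)
  have hmem : ∀ {j d}, d ∈ Set.Ioc (a j) (b j) → ¬ (j = i ∧ d = b i) →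
      d ∈ Set.Ioc (a j) (lowerAt b i j) := fun hd hne => mem_Ioc_lowerAt_iff.2 ⟨hd, hne⟩
  have hle_flag : ∀ j, ∀ d ∈ Set.Ioc (a j) (b j), setBox f i (b i) (P i) j d ≤ P j := by
    intro j d hd
    by_cases hbox : j = i ∧ d = b i
    · rw [hbox.1, hbox.2, setBox_self]
    · exact (hset hbox).trans_le (h.le_flag j d (hmem hd hbox))
  refine ⟨fun j d hd => ?_, fun j d hd => ?_, hle_flag, fun j d hd e he hde => ?_,
    fun j j' hjj' d hd hd' => ?_⟩
  · have hbox : ¬ (j = i ∧ d = b i) := by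
      rintro ⟨rfl, rfl⟩
      exact hd ⟨hi, le_rfl⟩
    rw [hset hbox]
    exact h.eq_zero j d fun hd' => hd (mem_Ioc_lowerAt_iff.1 hd').1
  · by_cases hbox : j = i ∧ d = b i
    · rwa [hbox.1, hbox.2, setBox_self]
    · rw [hset hbox]
      exact h.pos j d (hmem hd hbox)
  · by_cases hbox : j = i ∧ e = b i
    · obtain ⟨rfl, rfl⟩ := hbox
      exact (hle_flag j d hd).trans_eq (setBox_self ..).symm
    · have hbox' : ¬ (j = i ∧ d = b i) := by
        rintro ⟨rfl, rfl⟩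
        exact hbox ⟨rfl, he.2.antisymm hde⟩
      rw [hset hbox', hset hbox]
      exact h.row_mono j (hmem hd hbox') (hmem he hbox) hde
  · have hbox : ¬ (j = i ∧ d = b i) := by
      rintro ⟨rfl, rfl⟩
      exact (hcorner j' hjj'.lt).not_ge hd'.2
    by_cases hbox' : j' = i ∧ d - 1 = b i
    · obtain ⟨rfl, hd'⟩ := hbox'
      rw [hd', setBox_self]
      exact (hle_flag j d hd).trans_lt (hmax j hjj'.lt)
    · rw [hset hbox, hset hbox']
      exact h.col_lt j j' hjj' d (hmem hd hbox) (hmem hd' hbox')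

/-- The finite set of all fillings. -/
noncomputable def fillings [Finite ι] (a b P : ι → ℤ) : Finset (ι → ℤ → ℤ) :=
  (finite_setOf_isFilling a b P).toFinset

theorem mem_fillings [Finite ι] {a b P : ι → ℤ} {f : ι → ℤ → ℤ} :
    f ∈ fillings a b P ↔ IsFilling a b P f :=
  Set.Finite.mem_toFinset _

end Fillings

section FillingSum

variable {R : Type*} [CommSemiring R] {ι : Type*} [Fintype ι] [LinearOrder ι]

/-- The weight of a filling: the product of `u_k + v_{k+d}` over the boxes. -/
noncomputable def fillingWeight (u v : ℤ → R) (a b : ι → ℤ) (f : ι → ℤ → ℤ) : R :=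
  ∏ i, ∏ d ∈ Finset.Ioc (a i) (b i), (u (f i d) + v (f i d + d))

/-- The sum of the weights of all fillings. -/
noncomputable def fillingSum (u v : ℤ → R) (a b P : ι → ℤ) : R :=
  ∑ f ∈ fillings a b P, fillingWeight u v a b f

theorem fillingSum_lowerAt_flag_of_eq (u v : ℤ → R) {a b P : ι → ℤ} {i : ι} (hi : b i = a i) :
    fillingSum u v a b (lowerAt P i) = fillingSum u v a b P := by
  have hfillings : fillings a b (lowerAt P i) = fillings a b P := by
    ext f
    rw [mem_fillings, mem_fillings, isFilling_lowerAt_flag_iff_of_eq hi]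
  rw [fillingSum, hfillings, fillingSum]

theorem fillingSum_eq_lowerAt_flag_add (u v : ℤ → R) {a b P : ι → ℤ} {i : ι} (hi : a i < b i) :
    fillingSum u v a b P = fillingSum u v a b (lowerAt P i) +
      ∑ f ∈ fillings a b P with f i (b i) = P i, fillingWeight u v a b f := by
  have hfillings : fillings a b (lowerAt P i) = {f ∈ fillings a b P | ¬ f i (b i) = P i} := by
    ext f
    rw [Finset.mem_filter, mem_fillings, mem_fillings, isFilling_lowerAt_flag_iff hi]
  rw [fillingSum, fillingSum, hfillings, add_comm, Finset.sum_filter_add_sum_filter_not]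

theorem fillingWeight_eq_mul_eraseLast (u v : ℤ → R) {a b : ι → ℤ} {i : ι} (hi : a i < b i)
    (f : ι → ℤ → ℤ) :
    fillingWeight u v a b f = (u (f i (b i)) + v (f i (b i) + b i)) *
      fillingWeight u v a (lowerAt b i) (setBox f i (b i) 0) := by
  unfold fillingWeight
  rw [← Finset.mul_prod_erase _ _ (Finset.mem_univ i),
    ← Finset.mul_prod_erase (a := i) _ (fun j => ∏ d ∈ Finset.Ioc (a j) (lowerAt b i j), _)
      (Finset.mem_univ i), ← mul_assoc]
  have hrow : ∀ j, ∀ d ∈ Finset.Ioc (a j) (lowerAt b i j), setBox f i (b i) 0 j d = f j d :=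
    fun j d hd => setBox_of_ne f 0 (mem_Ioc_lowerAt_iff.1 (Finset.mem_Ioc.1 hd)).2
  have hlast : Finset.Ioc (a i) (b i) = insert (b i) (Finset.Ioc (a i) (lowerAt b i i)) := by
    ext d
    rw [lowerAt_self, Finset.mem_insert, Finset.mem_Ioc, Finset.mem_Ioc]
    omega
  congr 1
  · rw [hlast, Finset.prod_insert (by simp [lowerAt_self])]
    congr 1
    exact Finset.prod_congr rfl fun d hd => by rw [hrow i d hd]
  · refine Finset.prod_congr rfl fun j hj => ?_
    rw [← lowerAt_of_ne b (Finset.ne_of_mem_erase hj)]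
    exact Finset.prod_congr rfl fun d hd => by rw [hrow j d hd]

theorem sum_fillingWeight_last_eq_flag {u v : ℤ → R} (hu : ∀ k ≤ 0, u k = 0)
    (hv : ∀ k ≤ 0, v k = 0) {a b P : ι → ℤ} {i : ι} (hi : a i < b i) (hmax : ∀ j < i, P j < P i)
    (hcorner : ∀ j > i, b j < b i - 1) :
    ∑ f ∈ fillings a b P with f i (b i) = P i, fillingWeight u v a b f =
      (u (P i) + v (P i + b i)) * fillingSum u v a (lowerAt b i) P := by
  by_cases hpos : 0 < P i ∨ 0 < P i + b i
  · have hnotMem : b i ∉ Set.Ioc (a i) (lowerAt b i i) := fun h =>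
      (mem_Ioc_lowerAt_iff.1 h).2 ⟨rfl, rfl⟩
    rw [fillingSum, Finset.mul_sum]
    refine Finset.sum_bij' (fun f _ => setBox f i (b i) 0) (fun f _ => setBox f i (b i) (P i))
      ?_ ?_ ?_ ?_ ?_ <;> intro f hf <;>
      simp only [Finset.mem_filter, mem_fillings] at hf ⊢
    · exact hf.1.eraseLast i
    · exact ⟨hf.insertLast hi hpos hmax hcorner, setBox_self ..⟩
    · exact setBox_setBox_of_eq 0 hf.2
    · exact setBox_setBox_of_eq (P i) (hf.eq_zero i _ hnotMem)
    · rw [fillingWeight_eq_mul_eraseLast u v hi, hf.2]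
  · have hempty : {f ∈ fillings a b P | f i (b i) = P i} = ∅ := by
      refine Finset.filter_eq_empty_iff.2 fun f hf hlast => hpos ?_
      exact hlast ▸ (mem_fillings.1 hf).pos i _ ⟨hi, le_rfl⟩
    rw [hempty, Finset.sum_empty, hu _ (by omega), hv _ (by omega), add_zero, zero_mul]

theorem fillingSum_eq_lowerAt_flag_of_covBy (u v : ℤ → R) {a b P : ι → ℤ} (ha : StrictAnti a)
    {i i' : ι} (hi : a i < b i) (hii' : i ⋖ i') (hb : b i' = b i - 1) (hP : P i' ≤ P i) :
    fillingSum u v a b P = fillingSum u v a b (lowerAt P i) := by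
  have hempty : {f ∈ fillings a b P | f i (b i) = P i} = ∅ :=
    Finset.filter_eq_empty_iff.2 fun f hf => (mem_fillings.1 hf).last_ne_of_covBy ha hi hii' hb hP
  rw [fillingSum_eq_lowerAt_flag_add u v hi, hempty, Finset.sum_empty, add_zero]

theorem fillingSum_of_nonpos (u v : ℤ → R) {a b P : ι → ℤ} (hP : ∀ i, P i ≤ 0)
    (hPb : ∀ i, P i + b i ≤ 0) (hab : a ≤ b) :
    fillingSum u v a b P = if b = a then 1 else 0 := by
  have hmem : ∀ f, f ∈ fillings a b P ↔ f = 0 ∧ b ≤ a :=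
    fun f => mem_fillings.trans (IsFilling.iff_eq_of_nonpos hP hPb)
  split_ifs with hba
  · have hzero : fillings a b P = {0} := by
      ext f
      rw [hmem, Finset.mem_singleton, and_iff_left hba.le]
    rw [fillingSum, hzero, Finset.sum_singleton, fillingWeight, hba]
    simp
  · refine Finset.sum_eq_zero fun f hf => absurd ?_ hba
    exact ((hmem f).1 hf).2.antisymm hab

end FillingSum

section JacobiTrudi

variable {R : Type*} [CommRing R] {ι : Type*} [Fintype ι] [LinearOrder ι]

/-- The flagged double Jacobi–Trudi determinant. -/
noncomputable def flagDet (u v : ℤ → R) (a b P : ι → ℤ) : R :=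
  (Matrix.of fun k l => flagCoeff u v (P k) (b k) (a l)).det

theorem flagDet_eq_lowerAt_add {u v : ℤ → R} (hu : ∀ k ≤ 0, u k = 0) (hv : ∀ k ≤ 0, v k = 0)
    (a b P : ι → ℤ) (i : ι) :
    flagDet u v a b P = flagDet u v a b (lowerAt P i) +
      (u (P i) + v (P i + b i)) * flagDet u v a (lowerAt b i) P := by
  set M : Matrix ι ι R := Matrix.of fun k l => flagCoeff u v (P k) (b k) (a l) with hM
  set w := u (P i) + v (P i + b i)
  have hP : (Matrix.of fun k l => flagCoeff u v (lowerAt P i k) (b k) (a l)) =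
      M.updateRow i fun l => flagCoeff u v (P i - 1) (b i) (a l) := by
    ext k l
    rcases eq_or_ne k i with rfl | hk
    · simp [lowerAt_self]
    · simp [Matrix.updateRow_ne hk, lowerAt_of_ne P hk, hM]
  have hb : (Matrix.of fun k l => flagCoeff u v (P k) (lowerAt b i k) (a l)) =
      M.updateRow i fun l => flagCoeff u v (P i) (b i - 1) (a l) := by
    ext k l
    rcases eq_or_ne k i with rfl | hk
    · simp [lowerAt_self]
    · simp [Matrix.updateRow_ne hk, lowerAt_of_ne b hk, hM]
  have hrow : M i = (fun l => flagCoeff u v (P i - 1) (b i) (a l)) +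
      w • fun l => flagCoeff u v (P i) (b i - 1) (a l) :=
    funext fun l => flagCoeff_eq_add hu hv ..
  unfold flagDet
  rw [hP, hb, ← Matrix.det_updateRow_smul, ← Matrix.det_updateRow_add, ← hrow,
    Matrix.updateRow_eq_self]

theorem flagDet_lowerAt_eq_zero_of_eq (u v : ℤ → R) {a b : ι → ℤ} (P : ι → ℤ) (ha : StrictAnti a)
    (hb : StrictAnti b) {i : ι} (hi : b i = a i) : flagDet u v a (lowerAt b i) P = 0 := by
  refine det_eq_zero_of_forall_le i fun k l hk hl => flagCoeff_of_lt u v _ ?_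
  calc lowerAt b i k < a i := by
        rcases hk.eq_or_lt with rfl | hk
        · rw [lowerAt_self]
          omega
        · rw [lowerAt_of_ne b hk.ne', ← hi]
          exact hb hk
    _ ≤ a l := ha.antitone hl

theorem flagDet_lowerAt_eq_zero_of_lt (u v : ℤ → R) (a : ι → ℤ) {b P : ι → ℤ} {i i' : ι}
    (hii' : i < i') (hb : b i' = b i - 1) (hP : P i' = P i) :
    flagDet u v a (lowerAt b i) P = 0 := by
  refine Matrix.det_zero_of_row_eq hii'.ne ?_
  ext l
  rw [Matrix.of_apply, Matrix.of_apply, lowerAt_self, lowerAt_of_ne b hii'.ne', hb, hP]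

theorem flagDet_of_nonpos (u v : ℤ → R) {a b P : ι → ℤ} (hP : ∀ i, P i ≤ 0)
    (hPb : ∀ i, P i + b i ≤ 0) (ha : StrictAnti a) (hab : a ≤ b) :
    flagDet u v a b P = if b = a then 1 else 0 := by
  rw [flagDet, Matrix.det_of_isLowerTriangular]
  · simp only [Matrix.of_apply, flagCoeff_of_nonpos u v _ (hP _) (hPb _), Fintype.prod_boole,
      funext_iff]
  · intro k l (hkl : k < l)
    have hlt : a l < b k := (ha hkl).trans_le (hab k)
    rw [Matrix.of_apply, flagCoeff_of_nonpos u v _ (hP k) (hPb k), if_neg hlt.ne']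

theorem fillingSum_eq_flagDet_of_ge {u v : ℤ → R} (hu : ∀ k ≤ 0, u k = 0) (hv : ∀ k ≤ 0, v k = 0)
    {a b P : ι → ℤ} {B : ℤ} (ha : StrictAnti a) (hb : StrictAnti b) (hab : a ≤ b) (hP : Monotone P)
    (hB : B ≤ 0) (hBP : ∀ i, B ≤ P i) (hBb : ∀ i, B + b i ≤ 0) :
    fillingSum u v a b P = flagDet u v a b P := by
  by_cases hconst : ∀ i, P i ≤ B
  · have hPb : ∀ i, P i + b i ≤ 0 := fun i => (add_le_add_left (hconst i) _).trans (hBb i)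
    rw [fillingSum_of_nonpos u v (fun i => (hconst i).trans hB) hPb hab,
      flagDet_of_nonpos u v (fun i => (hconst i).trans hB) hPb ha hab]
  push Not at hconst
  have : Nonempty ι := hconst.nonempty
  obtain ⟨i, hmax, hfirst⟩ := exists_first_max P
  have hBi : B < P i := hconst.elim fun j hj => hj.trans_le (hmax j)
  have ihP : fillingSum u v a b (lowerAt P i) = flagDet u v a b (lowerAt P i) :=
    fillingSum_eq_flagDet_of_ge hu hv ha hb hab (monotone_lowerAt hP hfirst) hB
      (le_lowerAt (c := fun _ => B) hBP hBi) hBb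
  rw [flagDet_eq_lowerAt_add hu hv a b P i, ← ihP]
  rcases (hab i).eq_or_lt with hi | hi
  · rw [flagDet_lowerAt_eq_zero_of_eq u v P ha hb hi.symm, mul_zero, add_zero,
      fillingSum_lowerAt_flag_of_eq u v hi.symm]
  by_cases hcorner : ∀ j > i, b j < b i - 1
  · have ihb : fillingSum u v a (lowerAt b i) P = flagDet u v a (lowerAt b i) P :=
      fillingSum_eq_flagDet_of_ge hu hv ha (strictAnti_lowerAt hb hcorner) (le_lowerAt hab hi) hP
        hB hBP fun j => (add_le_add_right (lowerAt_le b i j) B).trans (hBb j)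
    rw [← ihb, ← sum_fillingWeight_last_eq_flag hu hv hi hfirst hcorner,
      fillingSum_eq_lowerAt_flag_add u v hi]
  · push Not at hcorner
    obtain ⟨j, hij, hj⟩ := hcorner
    obtain ⟨hb', hcov⟩ := eq_sub_one_and_covBy hb hij hj
    rw [flagDet_lowerAt_eq_zero_of_lt u v a hij hb' ((hmax j).antisymm (hP hij.le)), mul_zero,
      add_zero, fillingSum_eq_lowerAt_flag_of_covBy u v ha hi hcov hb' (hmax j)]
termination_by ∑ j, (b j - a j).toNat + ∑ j, (P j - B).toNat
decreasing_by
  · exact add_lt_add_right (sum_toNat_lowerAt_sub_lt (c := fun _ => B) hBi) _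
  · exact add_lt_add_left (sum_toNat_lowerAt_sub_lt hi) _

theorem fillingSum_eq_flagDet {u v : ℤ → R} (hu : ∀ k ≤ 0, u k = 0) (hv : ∀ k ≤ 0, v k = 0)
    {a b P : ι → ℤ} (ha : StrictAnti a) (hb : StrictAnti b) (hab : a ≤ b) (hP : Monotone P) :
    fillingSum u v a b P = flagDet u v a b P := by
  obtain ⟨B, hB⟩ := (Set.finite_range P).bddBelow
  obtain ⟨B', hB'⟩ := (Set.finite_range b).bddAbove
  refine fillingSum_eq_flagDet_of_ge (B := min 0 (min B (-B'))) hu hv ha hb hab hP (by omega)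
    (fun i => ?_) fun i => ?_
  · have := hB ⟨i, rfl⟩
    omega
  · have := hB' ⟨i, rfl⟩
    omega

end JacobiTrudi

section Expansion

variable {n : ℕ}

/-- The contents `λ_i - i` of the last boxes in the rows of `λ`, rows being numbered from `1`.
They turn weakly decreasing sequences into strictly decreasing ones. -/
def beta (lam : Fin n → ℤ) (i : Fin n) : ℤ :=
  lam i - ((i : ℤ) + 1)

theorem strictAnti_beta_iff {lam : Fin n → ℤ} : StrictAnti (beta lam) ↔ Antitone lam := by
  cases n with
  | zero => exact ⟨fun _ i => i.elim0, fun _ i => i.elim0⟩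
  | succ n =>
    rw [Fin.strictAnti_iff_succ_lt, Fin.antitone_iff_succ_le]
    refine forall_congr' fun i => ?_
    simp only [beta, Fin.val_succ, Fin.val_castSucc]
    omega

theorem injective_beta : Function.Injective (beta (n := n)) := fun lam mu h => by
  ext i
  have := congrFun h i
  simp only [beta] at this
  omega

theorem exists_beta_eq (g : Fin n → ℤ) : ∃ lam, beta lam = g :=
  ⟨fun i => g i + ((i : ℤ) + 1), funext fun _ => add_sub_cancel_right _ _⟩

variable {R : Type*} [CommRing R]

theorem skewSchur_eq_det_beta (f : Fin n → PowerSeries R) (lam mu : Fin n → ℤ) :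
    skewSchur f lam mu =
      (Matrix.of fun k l => intCoeff (f k) (beta lam k - beta mu l)).det := by
  unfold skewSchur beta
  congr! 5
  ring

theorem skewSchur_eq_zero_of_lt (f : Fin n → PowerSeries R) {lam mu : Fin n → ℤ}
    (hlam : Antitone lam) (hmu : Antitone mu) {i : Fin n} (h : lam i < mu i) :
    skewSchur f lam mu = 0 :=
  det_eq_zero_of_forall_le i fun k l hk hl => intCoeff_of_neg _ <| by
    have hk' := hlam hk
    have hl' := hmu hl
    rw [Fin.le_def] at hk hl
    omega

open Classical in
theorem skewSchur_mul (f : Fin n → PowerSeries R) (c : PowerSeries R) {lam nu : Fin n → ℤ}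
    (hlam : Antitone lam) (hnu : Antitone nu) :
    skewSchur (fun i => f i * c) lam nu =
      ∑ mu ∈ Fintype.piFinset fun i => Finset.Icc (nu i) (lam i) with Antitone mu,
        skewSchur f lam mu * skewSchur (fun _ => c) mu nu := by
  obtain ⟨A, hA⟩ := (Set.finite_range (beta nu)).bddBelow
  obtain ⟨B, hB⟩ := (Set.finite_range (beta lam)).bddAbove
  have hcoeff : ∀ k l, intCoeff (f k * c) (beta lam k - beta nu l) =
      ∑ z ∈ Finset.Icc A B, intCoeff (f k) (beta lam k - z) * intCoeff c (z - beta nu l) :=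
    fun k l => intCoeff_mul _ _ (hA ⟨l, rfl⟩) (hB ⟨k, rfl⟩)
  simp only [skewSchur_eq_det_beta (fun i => f i * c), hcoeff, cauchy_binet]
  symm
  refine Finset.sum_of_injOn beta injective_beta.injOn ?_ ?_ fun mu _ => by
    rw [skewSchur_eq_det_beta, skewSchur_eq_det_beta]
  · intro mu hmu
    simp only [Finset.coe_filter, Fintype.mem_piFinset, Finset.mem_Icc, Set.mem_ofPred_eq]
      at hmu ⊢
    refine ⟨fun j => ?_, strictAnti_beta_iff.2 hmu.2⟩
    have hAj : A ≤ beta nu j := hA ⟨j, rfl⟩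
    have hBj : beta lam j ≤ B := hB ⟨j, rfl⟩
    have hj := hmu.1 j
    unfold beta at *
    omega
  · intro g hg hnot
    obtain ⟨mu, rfl⟩ := exists_beta_eq g
    have hmu : Antitone mu := strictAnti_beta_iff.1 (Finset.mem_filter.1 hg).2
    rw [← skewSchur_eq_det_beta f, ← skewSchur_eq_det_beta fun _ => c]
    have hout : ∃ i, ¬ (nu i ≤ mu i ∧ mu i ≤ lam i) := by
      by_contra! hin
      exact hnot ⟨mu, by simpa [hmu] using hin, rfl⟩
    obtain ⟨i, hi⟩ := hout
    rcases lt_or_ge (mu i) (nu i) with h | h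
    · rw [skewSchur_eq_zero_of_lt (fun _ => c) hmu hnu h, mul_zero]
    · rw [skewSchur_eq_zero_of_lt f hlam hmu (i := i) (by omega), zero_mul]

theorem schur_mul (f : Fin n → PowerSeries R) (c : PowerSeries R) {lam : Fin n → ℤ}
    (hlam : Antitone lam) :
    schur (fun i => f i * c) lam =
      ∑ mu ∈ subpartitions lam, skewSchur f lam mu * schur (fun _ => c) mu :=
  skewSchur_mul f c hlam antitone_const

end Expansion

section Entries

/-- The sequence `a_1, a_2, …`, extended by zero to all integers. -/
def extendZero {R : Type*} [Zero R] (a : ℕ → R) (k : ℤ) : R :=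
  if 0 < k then a k.toNat else 0

theorem extendZero_of_nonpos {R : Type*} [Zero R] (a : ℕ → R) {k : ℤ} (hk : k ≤ 0) :
    extendZero a k = 0 :=
  if_neg hk.not_gt

theorem extendZero_of_pos {R : Type*} [Zero R] (a : ℕ → R) {k : ℤ} (hk : 0 < k) :
    extendZero a k = a k.toNat :=
  if_pos hk

/-- The weight of an entry: `a_k` for `k`, `b_l` for `l'`, and `a_k + b_l` for `(k, l')`. -/
def Entry.weight {R : Type*} [Add R] (a b : ℕ → R) : Entry → R
  | .plain k => a k
  | .primed l => b l
  | .pair k l => a k + b l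

/-- The integer `k` that encodes an entry on the diagonal `d`: the entry consists of those of `k`
and `(k + d)'` that are positive. -/
def Entry.toInt (d : ℤ) : Entry → ℤ
  | .plain k => k
  | .primed l => l - d
  | .pair k _ => k

/-- The entry on the diagonal `d` that the integer `k` encodes. -/
def Entry.ofInt (d k : ℤ) : Entry :=
  if 0 < k then if 0 < k + d then .pair k.toNat (k + d).toNat else .plain k.toNat
  else .primed (k + d).toNat

theorem mem_entries {P Q : ℕ} {e : Entry} : e ∈ entries P Q ↔ match e with
    | .plain k => 1 ≤ k ∧ k ≤ P
    | .primed l => 1 ≤ l ∧ l ≤ Q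
    | .pair k l => (1 ≤ k ∧ k ≤ P) ∧ 1 ≤ l ∧ l ≤ Q := by
  cases e <;> simp [entries, and_assoc]

theorem Entry.toInt_pos_or {P Q : ℕ} {e : Entry} {d : ℤ} (he : e ∈ entries P Q) :
    0 < e.toInt d ∨ 0 < e.toInt d + d := by
  rw [mem_entries] at he
  cases e <;> simp only [toInt] at he ⊢ <;> omega

theorem Entry.ofInt_toInt {P Q : ℕ} {e : Entry} {d : ℤ} (he : e ∈ entries P Q)
    (hd : DiagonalRule d e) : ofInt d (e.toInt d) = e := by
  rw [mem_entries] at he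
  generalize hk : e.toInt d = k
  unfold ofInt
  cases e <;> simp only [toInt, DiagonalRule] at he hd hk <;> split_ifs <;>
    first | omega | (congr 1 <;> omega)

theorem Entry.toInt_ofInt {d k : ℤ} (h : 0 < k ∨ 0 < k + d) : (ofInt d k).toInt d = k := by
  unfold ofInt
  split_ifs <;> simp only [toInt] <;> omega

theorem diagonalRule_ofInt {d k : ℤ} (h : 0 < k ∨ 0 < k + d) :
    DiagonalRule d (Entry.ofInt d k) := by
  unfold Entry.ofInt
  split_ifs <;> simp only [DiagonalRule] <;> omega

theorem Entry.ofInt_mem_entries_iff {P Q : ℕ} {d k : ℤ} (h : 0 < k ∨ 0 < k + d)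
    (hPQ : P + d ≤ Q) : ofInt d k ∈ entries P Q ↔ k ≤ P := by
  rw [mem_entries]
  unfold ofInt
  split_ifs <;> simp only <;> omega

theorem Entry.plain?_ofInt (d k : ℤ) :
    (ofInt d k).plain? = if 0 < k then some k.toNat else none := by
  unfold ofInt
  split_ifs <;> rfl

theorem Entry.primed?_ofInt {d k : ℤ} (h : 0 < k ∨ 0 < k + d) :
    (ofInt d k).primed? = if 0 < k + d then some (k + d).toNat else none := by
  unfold ofInt
  split_ifs <;> first | rfl | omega

theorem Entry.ofInt_eq_pair_iff {d k : ℤ} {a b : ℕ} :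
    ofInt d k = .pair a b ↔ 0 < k ∧ 0 < k + d ∧ k.toNat = a ∧ (k + d).toNat = b := by
  unfold ofInt
  split_ifs <;> simp <;> omega

theorem rowRule_ofInt_iff {d k k' : ℤ} (h : 0 < k ∨ 0 < k + d) (h' : 0 < k' ∨ 0 < k' + (d + 1)) :
    RowRule (Entry.ofInt d k) (Entry.ofInt (d + 1) k') ↔ k ≤ k' := by
  simp only [RowRule, Entry.plain?_ofInt, Entry.primed?_ofInt h, Entry.primed?_ofInt h',
    Entry.ofInt_eq_pair_iff, Option.ite_none_right_eq_some, Option.some.injEq]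
  constructor
  · rintro ⟨hplain, hprimed, -⟩
    by_cases hk : 0 < k
    · obtain ⟨_, _, _⟩ := hplain _ ⟨hk, rfl⟩
      omega
    · obtain ⟨_, _, _⟩ := hprimed _ ⟨by omega, rfl⟩
      omega
  · intro hk
    exact ⟨fun _ _ => ⟨k'.toNat, by omega, by omega⟩,
      fun _ _ => ⟨(k' + (d + 1)).toNat, by omega, by omega⟩,
      fun _ _ _ => ⟨(k' - k).toNat, by omega⟩⟩

theorem columnRule_ofInt_iff {d k k' : ℤ} (h : 0 < k ∨ 0 < k + d)
    (h' : 0 < k' ∨ 0 < k' + (d - 1)) :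
    ColumnRule (Entry.ofInt d k) (Entry.ofInt (d - 1) k') ↔ k < k' := by
  simp only [ColumnRule, Entry.plain?_ofInt, Entry.primed?_ofInt h, Entry.primed?_ofInt h',
    Entry.ofInt_eq_pair_iff, Option.ite_none_right_eq_some, Option.some.injEq]
  constructor
  · rintro ⟨hplain, hprimed, -⟩
    by_cases hk : 0 < k
    · obtain ⟨_, _, _⟩ := hplain _ ⟨hk, rfl⟩
      omega
    · obtain ⟨_, _, _⟩ := hprimed _ ⟨by omega, rfl⟩
      omega
  · intro hk
    exact ⟨fun _ _ => ⟨k'.toNat, by omega, by omega⟩,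
      fun _ _ => ⟨(k' + (d - 1)).toNat, by omega, by omega⟩,
      fun _ _ _ => ⟨(k' - k - 1).toNat, by omega⟩⟩

theorem Entry.weight_ofInt {R : Type*} [AddMonoid R] (a b : ℕ → R) {d k : ℤ}
    (h : 0 < k ∨ 0 < k + d) :
    (ofInt d k).weight a b = extendZero a k + extendZero b (k + d) := by
  unfold ofInt extendZero
  split_ifs <;> first | omega | simp [weight]

end Entries

section Tableaux

variable {n : ℕ} {lam mu : Fin n → ℤ}

theorem Box.diag_mem (b : Box lam mu) : b.diag ∈ Set.Ioc (beta mu b.1) (beta lam b.1) := by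
  have hj := Finset.mem_Ioc.1 b.2.2
  unfold diag beta
  constructor <;> omega

theorem Box.exists_diag_eq {i : Fin n} {d : ℤ} (hd : d ∈ Set.Ioc (beta mu i) (beta lam i)) :
    ∃ b : Box lam mu, b.1 = i ∧ b.diag = d := by
  simp only [beta, Set.mem_Ioc] at hd
  exact ⟨⟨i, d + ((i : ℤ) + 1), Finset.mem_Ioc.2 (by omega)⟩, rfl, add_sub_cancel_right _ _⟩

theorem Box.ext_diag {b b' : Box lam mu} (hrow : b.1 = b'.1) (hdiag : b.diag = b'.diag) :
    b = b' := by
  obtain ⟨i, j, hj⟩ := b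
  obtain ⟨i', j', hj'⟩ := b'
  obtain rfl : i = i' := hrow
  obtain rfl : j = j' := sub_left_injective hdiag
  rfl

theorem Box.isRightOf_iff {b b' : Box lam mu} :
    b'.IsRightOf b ↔ b'.1 = b.1 ∧ b'.diag = b.diag + 1 := by
  refine and_congr_right fun h => ?_
  simp only [diag, h]
  omega

theorem Box.isBelow_iff {b b' : Box lam mu} :
    b'.IsBelow b ↔ b.1 ⋖ b'.1 ∧ b'.diag = b.diag - 1 := by
  unfold IsBelow diag
  rw [Fin.covBy_iff, Nat.covBy_iff_add_one_eq, eq_comm, and_congr_right_iff]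
  omega

theorem prod_box {M : Type*} [CommMonoid M] (F : Fin n → ℤ → M) :
    ∏ b : Box lam mu, F b.1 b.diag =
      ∏ i, ∏ d ∈ Finset.Ioc (beta mu i) (beta lam i), F i d := by
  rw [Fintype.prod_sigma]
  refine Finset.prod_congr rfl fun i _ => ?_
  refine (Finset.prod_coe_sort _ fun j => F i (j - ((i : ℤ) + 1))).trans ?_
  refine Finset.prod_equiv (Equiv.subRight ((i : ℤ) + 1)) (fun j => ?_) fun _ _ => rfl
  simp only [beta, Equiv.subRight_apply, Finset.mem_Ioc]
  omega

open Classical in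
/-- The filling by integers that encodes a tableau. -/
noncomputable def toFilling (T : Box lam mu → Entry) (i : Fin n) (d : ℤ) : ℤ :=
  if h : ∃ b : Box lam mu, b.1 = i ∧ b.diag = d then (T h.choose).toInt d else 0

theorem toFilling_apply (T : Box lam mu → Entry) (b : Box lam mu) :
    toFilling T b.1 b.diag = (T b).toInt b.diag := by
  have h : ∃ b' : Box lam mu, b'.1 = b.1 ∧ b'.diag = b.diag := ⟨b, rfl, rfl⟩
  rw [toFilling, dif_pos h, Box.ext_diag h.choose_spec.1 h.choose_spec.2]

theorem toFilling_of_notMem (T : Box lam mu → Entry) {i : Fin n} {d : ℤ}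
    (hd : d ∉ Set.Ioc (beta mu i) (beta lam i)) : toFilling T i d = 0 :=
  dif_neg <| by
    rintro ⟨b, rfl, rfl⟩
    exact hd b.diag_mem

/-- The tableau that a filling by integers encodes. -/
def ofFilling (lam mu : Fin n → ℤ) (f : Fin n → ℤ → ℤ) (b : Box lam mu) : Entry :=
  .ofInt b.diag (f b.1 b.diag)

theorem mem_tableaux {P Q : Fin n → ℕ} {T : Box lam mu → Entry} :
    T ∈ tableaux lam mu P Q ↔ (∀ b, T b ∈ entries (P b.1) (Q b.1)) ∧
      (∀ b b' : Box lam mu, b'.IsRightOf b → RowRule (T b) (T b')) ∧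
      (∀ b b' : Box lam mu, b'.IsBelow b → ColumnRule (T b) (T b')) ∧
      ∀ b : Box lam mu, DiagonalRule b.diag (T b) := by
  simp only [tableaux, Finset.mem_filter, Fintype.mem_piFinset]

theorem Box.forall_iff {p : Fin n → ℤ → Prop} :
    (∀ b : Box lam mu, p b.1 b.diag) ↔ ∀ i, ∀ d ∈ Set.Ioc (beta mu i) (beta lam i), p i d := by
  refine ⟨fun h i d hd => ?_, fun h b => h b.1 _ b.diag_mem⟩
  obtain ⟨b, rfl, rfl⟩ := exists_diag_eq hd
  exact h b

variable {f : Fin n → ℤ → ℤ}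

theorem forall_rowRule_ofFilling_iff
    (hpos : ∀ b : Box lam mu, 0 < f b.1 b.diag ∨ 0 < f b.1 b.diag + b.diag) :
    (∀ b b' : Box lam mu, b'.IsRightOf b →
      RowRule (ofFilling lam mu f b) (ofFilling lam mu f b')) ↔
      ∀ i, MonotoneOn (f i) (Set.Ioc (beta mu i) (beta lam i)) := by
  have hrule : ∀ b b' : Box lam mu, b'.IsRightOf b →
      (RowRule (ofFilling lam mu f b) (ofFilling lam mu f b') ↔
        f b.1 b.diag ≤ f b.1 (b.diag + 1)) := fun b b' h => by
    obtain ⟨hrow, hdiag⟩ := Box.isRightOf_iff.1 h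
    have hpos' := hpos b'
    rw [hrow, hdiag] at hpos'
    rw [ofFilling, ofFilling, hrow, hdiag, rowRule_ofInt_iff (hpos b) hpos']
  constructor
  · intro h i
    refine monotoneOn_of_le_succ Set.ordConnected_Ioc fun d _ hd hd' => ?_
    obtain ⟨b, rfl, rfl⟩ := Box.exists_diag_eq hd
    obtain ⟨b', hrow, hdiag⟩ := Box.exists_diag_eq hd'
    have hb' : b'.IsRightOf b := Box.isRightOf_iff.2 ⟨hrow, hdiag⟩
    exact (hrule b b' hb').1 (h b b' hb')
  · intro h b b' hb'
    obtain ⟨hrow, hdiag⟩ := Box.isRightOf_iff.1 hb'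
    have hmem := b'.diag_mem
    rw [hrow, hdiag] at hmem
    exact (hrule b b' hb').2 (h b.1 b.diag_mem hmem (by omega))

theorem forall_columnRule_ofFilling_iff
    (hpos : ∀ b : Box lam mu, 0 < f b.1 b.diag ∨ 0 < f b.1 b.diag + b.diag) :
    (∀ b b' : Box lam mu, b'.IsBelow b →
      ColumnRule (ofFilling lam mu f b) (ofFilling lam mu f b')) ↔
      ∀ i i', i ⋖ i' → ∀ d ∈ Set.Ioc (beta mu i) (beta lam i),
        d - 1 ∈ Set.Ioc (beta mu i') (beta lam i') → f i d < f i' (d - 1) := by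
  have hrule : ∀ b b' : Box lam mu, b'.IsBelow b →
      (ColumnRule (ofFilling lam mu f b) (ofFilling lam mu f b') ↔
        f b.1 b.diag < f b'.1 (b.diag - 1)) := fun b b' h => by
    have hdiag := (Box.isBelow_iff.1 h).2
    have hpos' := hpos b'
    rw [hdiag] at hpos'
    rw [ofFilling, ofFilling, hdiag, columnRule_ofInt_iff (hpos b) hpos']
  constructor
  · intro h i i' hcov d hd hd'
    obtain ⟨b, rfl, rfl⟩ := Box.exists_diag_eq hd
    obtain ⟨b', rfl, hdiag⟩ := Box.exists_diag_eq hd'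
    have hb' : b'.IsBelow b := Box.isBelow_iff.2 ⟨hcov, hdiag⟩
    exact (hrule b b' hb').1 (h b b' hb')
  · intro h b b' hb'
    obtain ⟨hcov, hdiag⟩ := Box.isBelow_iff.1 hb'
    exact (hrule b b' hb').2 (h b.1 b'.1 hcov b.diag b.diag_mem (hdiag ▸ b'.diag_mem))

theorem ofFilling_mem_tableaux_iff {P Q : Fin n → ℕ} (hPQ : ∀ i, (Q i : ℤ) = P i + beta lam i)
    (hoff : ∀ i, ∀ d ∉ Set.Ioc (beta mu i) (beta lam i), f i d = 0)
    (hpos : ∀ b : Box lam mu, 0 < f b.1 b.diag ∨ 0 < f b.1 b.diag + b.diag) :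
    ofFilling lam mu f ∈ tableaux lam mu P Q ↔
      IsFilling (beta mu) (beta lam) (fun i => P i) f := by
  have hentries : (∀ b, ofFilling lam mu f b ∈ entries (P b.1) (Q b.1)) ↔
      ∀ i, ∀ d ∈ Set.Ioc (beta mu i) (beta lam i), f i d ≤ P i := by
    rw [← Box.forall_iff]
    refine forall_congr' fun b => Entry.ofInt_mem_entries_iff (hpos b) ?_
    have := b.diag_mem.2
    have := hPQ b.1
    omega
  rw [mem_tableaux, hentries, forall_rowRule_ofFilling_iff hpos,
    forall_columnRule_ofFilling_iff hpos]
  exact ⟨fun ⟨hle, hrow, hcol, _⟩ => ⟨hoff, Box.forall_iff.1 hpos, hle, hrow, hcol⟩,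
    fun h => ⟨h.le_flag, h.row_mono, h.col_lt, fun b => diagonalRule_ofInt (hpos b)⟩⟩

theorem ofFilling_toFilling {P Q : Fin n → ℕ} {T : Box lam mu → Entry}
    (hT : T ∈ tableaux lam mu P Q) : ofFilling lam mu (toFilling T) = T := by
  obtain ⟨hentries, -, -, hdiag⟩ := mem_tableaux.1 hT
  ext1 b
  rw [ofFilling, toFilling_apply, Entry.ofInt_toInt (hentries b) (hdiag b)]

theorem isFilling_toFilling {P Q : Fin n → ℕ} (hPQ : ∀ i, (Q i : ℤ) = P i + beta lam i)
    {T : Box lam mu → Entry} (hT : T ∈ tableaux lam mu P Q) :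
    IsFilling (beta mu) (beta lam) (fun i => P i) (toFilling T) := by
  refine (ofFilling_mem_tableaux_iff hPQ (fun i d hd => toFilling_of_notMem T hd) fun b => ?_).1
    (by rwa [ofFilling_toFilling hT])
  rw [toFilling_apply]
  exact Entry.toInt_pos_or ((mem_tableaux.1 hT).1 b)

theorem IsFilling.pos_diag {P : Fin n → ℤ} (hf : IsFilling (beta mu) (beta lam) P f)
    (b : Box lam mu) : 0 < f b.1 b.diag ∨ 0 < f b.1 b.diag + b.diag :=
  hf.pos _ _ b.diag_mem

theorem toFilling_ofFilling {P : Fin n → ℤ} (hf : IsFilling (beta mu) (beta lam) P f) :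
    toFilling (ofFilling lam mu f) = f := by
  ext i d
  by_cases hd : d ∈ Set.Ioc (beta mu i) (beta lam i)
  · obtain ⟨b, rfl, rfl⟩ := Box.exists_diag_eq hd
    rw [toFilling_apply, ofFilling, Entry.toInt_ofInt (hf.pos_diag b)]
  · rw [toFilling_of_notMem _ hd, hf.eq_zero i d hd]

theorem prod_weight_ofFilling {R : Type*} [CommSemiring R] (a b : ℕ → R) {P : Fin n → ℤ}
    (hf : IsFilling (beta mu) (beta lam) P f) :
    ∏ c, (ofFilling lam mu f c).weight a b =
      fillingWeight (extendZero a) (extendZero b) (beta mu) (beta lam) f := by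
  rw [fillingWeight, ← prod_box fun i d => extendZero a (f i d) + extendZero b (f i d + d)]
  exact Finset.prod_congr rfl fun c _ => Entry.weight_ofInt a b (hf.pos_diag c)

theorem sum_tableaux_eq_skewSchur {R : Type*} [CommRing R] (a b : ℕ → R) {P Q : Fin n → ℕ}
    (hlam : Antitone lam) (hmu : Antitone mu) (hle : mu ≤ lam) (hP : Monotone P)
    (hPQ : ∀ i, (Q i : ℤ) = P i + beta lam i) :
    ∑ T ∈ tableaux lam mu P Q, ∏ c, (T c).weight a b =
      skewSchur (fun i => flagSeries (extendZero a) (extendZero b) (P i) (Q i)) lam mu := by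
  calc ∑ T ∈ tableaux lam mu P Q, ∏ c, (T c).weight a b
    _ = fillingSum (extendZero a) (extendZero b) (beta mu) (beta lam) fun i => P i := by
      refine (Finset.sum_nbij' (ofFilling lam mu) toFilling (fun f hf => ?_) (fun T hT => ?_)
        (fun f hf => ?_) (fun T hT => ofFilling_toFilling hT) fun f hf => ?_).symm
      · rw [mem_fillings] at hf
        exact (ofFilling_mem_tableaux_iff hPQ hf.eq_zero hf.pos_diag).2 hf
      · exact mem_fillings.2 (isFilling_toFilling hPQ hT)
      · exact toFilling_ofFilling (mem_fillings.1 hf)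
      · exact (prod_weight_ofFilling a b (mem_fillings.1 hf)).symm
    _ = flagDet (extendZero a) (extendZero b) (beta mu) (beta lam) fun i => P i :=
      fillingSum_eq_flagDet (fun _ => extendZero_of_nonpos a) (fun _ => extendZero_of_nonpos b)
        (strictAnti_beta_iff.2 hmu) (strictAnti_beta_iff.2 hlam)
        (fun i => sub_le_sub_right (hle i) _) fun i j hij => by exact_mod_cast hP hij
    _ = skewSchur (fun i => flagSeries (extendZero a) (extendZero b) (P i) (Q i)) lam mu := by
      simp only [skewSchur_eq_det_beta, flagDet, flagCoeff, hPQ]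

end Tableaux

section Words

theorem alternating_prefix_perm (A B : ℕ → Letter) {m k m' k' : ℕ} {L : List (ℕ × ℕ)}
    (hL : ((m, k) :: L).Pairwise fun e f => e.1 ≤ f.1 ∧ e.2 ≤ f.2) (h : (m', k') ∈ L) :
    ∃ W, W <+: alternating A B m k L ∧
      W.Perm ((List.Ico m m').map (fun t => A (t + 1)) ++
        (List.Ico k k').map fun t => B (t + 1)) := by
  induction L generalizing m k with
  | nil => simp at h
  | cons e L ih =>
    obtain ⟨m₁, k₁⟩ := e
    rw [List.pairwise_cons] at hL
    have hblock : ∀ (F : ℕ → Letter) (a b : ℕ),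
        (List.range (b - a)).map (fun t => F (a + t + 1)) =
          (List.Ico a b).map fun t => F (t + 1) := fun F a b => by
      rw [List.Ico, List.range'_eq_map_range, List.map_map]
      rfl
    rw [alternating, hblock, hblock]
    rcases List.mem_cons.1 h with h | h
    · obtain ⟨rfl, rfl⟩ := Prod.mk.inj h
      exact ⟨_, List.prefix_append _ _, .refl _⟩
    · obtain ⟨W, hW, hperm⟩ := ih hL.2 h
      obtain ⟨hm, hk⟩ : m ≤ m₁ ∧ k ≤ k₁ := hL.1 _ List.mem_cons_self
      obtain ⟨hm', hk'⟩ : m₁ ≤ m' ∧ k₁ ≤ k' := (List.pairwise_cons.1 hL.2).1 _ h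
      refine ⟨_, (List.prefix_append_right_inj _).2 hW, (hperm.append_left _).trans ?_⟩
      rw [← List.Ico.append_consecutive hm hm', ← List.Ico.append_consecutive hk hk',
        List.map_append, List.map_append]
      simp only [List.append_assoc]
      exact (List.perm_append_comm_assoc _ _ _).append_left _

theorem getD_alternating_of_forall_lt (A B : ℕ → Letter) {L : List (ℕ × ℕ)} {t : ℕ}
    (h : ∀ e ∈ L, t < e.1) : (alternating A B 0 0 L).getD t (A (t + 1)) = A (t + 1) := by
  cases L with
  | nil => rfl
  | cons e L =>
    have ht : t < e.1 := h e List.mem_cons_self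
    rw [alternating, List.append_assoc, List.getD_append _ _ _ _ (by simpa using ht)]
    simp [ht]

variable {S : Type*} [CommMonoid S]

theorem prod_range_getD_of_isPrefix (g : Letter → S) {W V : List Letter} (h : W <+: V)
    (d : ℕ → Letter) :
    ∏ t ∈ Finset.range W.length, g (V.getD t (d t)) = (W.map g).prod := by
  obtain ⟨W', rfl⟩ := h
  rw [Finset.prod_range, ← Fin.prod_univ_fun_getElem]
  exact Fintype.prod_congr _ _ fun t => by rw [List.getD_append _ _ _ _ t.2, List.getD_eq_getElem]

theorem prod_getD_alternating {α : Type*} (g : Letter → S) (A B : ℕ → Letter) {rows : List α}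
    {m k : α → ℕ} (hrows : rows.Pairwise fun i j => m i ≤ m j ∧ k i ≤ k j) {i : α}
    (hi : i ∈ rows ∨ k i = 0 ∧ ∀ j ∈ rows, m i ≤ m j) :
    ∏ t ∈ Finset.range (m i + k i),
        g ((alternating A B 0 0 (rows.map fun j => (m j, k j))).getD t (A (t + 1))) =
      (∏ t ∈ Finset.range (m i), g (A (t + 1))) * ∏ t ∈ Finset.range (k i), g (B (t + 1)) := by
  rcases hi with hi | ⟨hk, hm⟩
  · obtain ⟨W, hW, hperm⟩ := alternating_prefix_perm A B (m := 0) (k := 0)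
      (List.pairwise_cons.2 ⟨fun _ _ => ⟨zero_le, zero_le⟩, List.pairwise_map.2 hrows⟩)
      (List.mem_map_of_mem (f := fun j => (m j, k j)) hi)
    have hlen : W.length = m i + k i := by simpa using hperm.length_eq
    rw [← hlen, prod_range_getD_of_isPrefix g hW fun t => A (t + 1), (hperm.map g).prod_eq]
    simp only [List.map_append, List.map_map, List.prod_append, List.Ico.zero_bot]
    rfl
  · rw [hk, add_zero, Finset.prod_range_zero, mul_one]
    refine Finset.prod_congr rfl fun t ht => congrArg g (getD_alternating_of_forall_lt A B ?_)
    simpa using fun j hj => (Finset.mem_range.1 ht).trans_le (hm j hj)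

end Words

theorem exists_forall_mem_iff_lt {n : ℕ} {U : Set (Fin n)} (hU : IsLowerSet U) :
    ∃ r ≤ n, ∀ i : Fin n, i ∈ U ↔ (i : ℕ) < r := by
  rcases hU.eq_univ_or_Iio with rfl | ⟨j, rfl⟩
  · exact ⟨n, le_rfl, fun i => by simp⟩
  · exact ⟨j, j.2.le, fun i => Fin.lt_def⟩

namespace CompleteTriple

variable {n : ℕ}

theorem nonempty_division (τ : CompleteTriple n) : Nonempty τ.Division := by
  obtain ⟨r, hrn, hr⟩ := exists_forall_mem_iff_lt (U := {i | τ.p i ≤ 0 ∧ 0 ≤ τ.q i})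
    fun i j hji hi => ⟨(τ.p_mono hji).trans hi.1, hi.2.trans (τ.q_anti hji)⟩
  obtain ⟨s, hsn, hs⟩ := exists_forall_mem_iff_lt (U := {i | τ.p i < 0 ∨ 0 < τ.q i})
    fun i j hji hi => hi.imp (τ.p_mono hji).trans_lt fun h => h.trans_le (τ.q_anti hji)
  simp only [Set.mem_ofPred_eq] at hr hs
  have hupper (i : Fin n) (hi : (i : ℕ) + 1 ≤ r) : τ.p i ≤ 0 ∧ 0 ≤ τ.q i := (hr i).2 hi
  have hlower (i : Fin n) (hi : max (r + 1) (s + 1) ≤ (i : ℕ) + 1) : 0 ≤ τ.p i ∧ τ.q i ≤ 0 := by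
    have := hs i
    omega
  have hmiddle (i : Fin n) (hri : r < (i : ℕ) + 1) (his : (i : ℕ) + 1 < max (r + 1) (s + 1)) :
      0 < τ.p i ∧ 0 < τ.q i ∨ τ.p i < 0 ∧ τ.q i < 0 := by
    have := hr i
    have := hs i
    omega
  by_cases hneg : ∃ j, τ.p j < 0 ∧ τ.q j < 0
  · obtain ⟨j, hpj, hqj⟩ := hneg
    refine ⟨⟨r, max (r + 1) (s + 1), .nonpos, by omega, by omega, hupper, hlower,
      fun i hri his => ?_⟩⟩
    rcases hmiddle i hri his with ⟨hpi, hqi⟩ | h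
    · rcases le_total i j with hij | hji
      · exact absurd (τ.p_mono hij) (by omega)
      · exact absurd (τ.q_anti hji) (by omega)
    · exact ⟨h.1.le, h.2.le⟩
  · refine ⟨⟨r, max (r + 1) (s + 1), .nonneg, by omega, by omega, hupper, hlower,
      fun i hri his => ?_⟩⟩
    exact ((hmiddle i hri his).resolve_right fun h => hneg ⟨i, h⟩).imp le_of_lt le_of_lt

namespace Division

variable {τ : CompleteTriple n} (D : τ.Division)

theorem p_nonneg_of_r_lt (hD : D.sign = .nonneg) {i : Fin n} (hi : D.r < (i : ℕ) + 1) :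
    0 ≤ τ.p i := by
  by_cases hs : (i : ℕ) + 1 < D.s
  · exact (by simpa only [hD] using D.middle i hi hs : 0 ≤ τ.p i ∧ 0 ≤ τ.q i).1
  · exact (D.lower i (not_lt.1 hs)).1

theorem q_nonpos_of_r_lt (hD : D.sign = .nonpos) {i : Fin n} (hi : D.r < (i : ℕ) + 1) :
    τ.q i ≤ 0 := by
  by_cases hs : (i : ℕ) + 1 < D.s
  · exact (by simpa only [hD] using D.middle i hi hs : τ.p i ≤ 0 ∧ τ.q i ≤ 0).2
  · exact (D.lower i (not_lt.1 hs)).2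

theorem q_nonneg_of_lt_s (hD : D.sign = .nonneg) {i : Fin n} (hi : (i : ℕ) + 1 < D.s) :
    0 ≤ τ.q i := by
  by_cases hr : D.r < (i : ℕ) + 1
  · exact (by simpa only [hD] using D.middle i hr hi : 0 ≤ τ.p i ∧ 0 ≤ τ.q i).2
  · exact (D.upper i (not_lt.1 hr)).2

theorem p_nonpos_of_lt_s (hD : D.sign = .nonpos) {i : Fin n} (hi : (i : ℕ) + 1 < D.s) :
    τ.p i ≤ 0 := by
  by_cases hr : D.r < (i : ℕ) + 1
  · exact (by simpa only [hD] using D.middle i hr hi : τ.p i ≤ 0 ∧ τ.q i ≤ 0).1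
  · exact (D.upper i (not_lt.1 hr)).1

theorem plainFlag_eq (i : Fin n) : D.plainFlag i = (τ.p i).toNat + (-τ.q i).toNat := by
  have hupper := D.upper i
  have hlower := D.lower i
  have hmiddle := D.middle i
  unfold plainFlag
  cases hD : D.sign <;> simp only [hD] at hmiddle ⊢ <;> split_ifs <;> omega

theorem primedFlag_eq (i : Fin n) : D.primedFlag i = (τ.q i).toNat + (-τ.p i).toNat := by
  have hupper := D.upper i
  have hlower := D.lower i
  have hmiddle := D.middle i
  have hrs := D.r_lt_s
  unfold primedFlag
  cases hD : D.sign <;> simp only [hD] at hmiddle ⊢ <;> split_ifs <;> omega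

theorem monotone_plainFlag : Monotone D.plainFlag := fun i j hij => by
  rw [plainFlag_eq, plainFlag_eq]
  exact add_le_add (Int.toNat_le_toNat (τ.p_mono hij))
    (Int.toNat_le_toNat (neg_le_neg (τ.q_anti hij)))

theorem primedFlag_eq_plainFlag_add (i : Fin n) :
    (D.primedFlag i : ℤ) = D.plainFlag i + beta τ.shape i := by
  rw [plainFlag_eq, primedFlag_eq, beta, shape]
  omega

theorem mem_upperRows {i : Fin n} : i ∈ D.upperRows ↔ (i : ℕ) + 1 ≤ D.r := by
  simp [upperRows]

theorem mem_lowerRows {i : Fin n} : i ∈ D.lowerRows ↔ D.s ≤ (i : ℕ) + 1 := by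
  simp [lowerRows]

theorem pairwise_upperRows : D.upperRows.Pairwise fun i j => j ≤ i :=
  List.pairwise_reverse.2 (((List.pairwise_lt_finRange n).imp fun h => h.le).filter _)

theorem pairwise_lowerRows : D.lowerRows.Pairwise fun i j => i ≤ j :=
  ((List.pairwise_lt_finRange n).imp fun h => h.le).filter _

variable {S : Type*} [CommMonoid S]

theorem prod_vLetter (g : Letter → S) (i : Fin n) :
    ∏ t ∈ Finset.range (D.primedFlag i), g (D.vLetter (t + 1)) =
      (∏ t ∈ Finset.range (τ.q i).toNat, g (.y (t + 1))) *
        ∏ t ∈ Finset.range (-τ.p i).toNat, g (.xt (t + 1)) := by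
  have hq {j k : Fin n} (h : k ≤ j) : (τ.q j).toNat ≤ (τ.q k).toNat :=
    Int.toNat_le_toNat (τ.q_anti h)
  have hp {j k : Fin n} (h : k ≤ j) : (-τ.p j).toNat ≤ (-τ.p k).toNat :=
    Int.toNat_le_toNat (neg_le_neg (τ.p_mono h))
  have hmem : i ∈ D.upperRows ∨ D.r < (i : ℕ) + 1 ∧ ∀ j ∈ D.upperRows, j ≤ i := by
    rw [mem_upperRows]
    refine (le_or_gt _ _).imp_right fun h => ⟨h, fun j hj => Fin.le_def.2 ?_⟩
    have := D.mem_upperRows.1 hj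
    omega
  rw [primedFlag_eq]
  unfold vLetter vWord
  cases hD : D.sign
  · refine prod_getD_alternating g .y .xt (D.pairwise_upperRows.imp fun h => ⟨hq h, hp h⟩)
      (hmem.imp_right fun h => ⟨?_, fun j hj => hq (h.2 j hj)⟩)
    exact Int.toNat_of_nonpos (neg_nonpos.2 (D.p_nonneg_of_r_lt hD h.1))
  · rw [add_comm, mul_comm]
    refine prod_getD_alternating g .xt .y (D.pairwise_upperRows.imp fun h => ⟨hp h, hq h⟩)
      (hmem.imp_right fun h => ⟨?_, fun j hj => hp (h.2 j hj)⟩)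
    exact Int.toNat_of_nonpos (D.q_nonpos_of_r_lt hD h.1)

theorem prod_uLetter (g : Letter → S) (i : Fin n) :
    ∏ t ∈ Finset.range (D.plainFlag i), g (D.uLetter (t + 1)) =
      (∏ t ∈ Finset.range (τ.p i).toNat, g (.x (t + 1))) *
        ∏ t ∈ Finset.range (-τ.q i).toNat, g (.yt (t + 1)) := by
  have hp {j k : Fin n} (h : j ≤ k) : (τ.p j).toNat ≤ (τ.p k).toNat :=
    Int.toNat_le_toNat (τ.p_mono h)
  have hq {j k : Fin n} (h : j ≤ k) : (-τ.q j).toNat ≤ (-τ.q k).toNat :=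
    Int.toNat_le_toNat (neg_le_neg (τ.q_anti h))
  have hmem : i ∈ D.lowerRows ∨ (i : ℕ) + 1 < D.s ∧ ∀ j ∈ D.lowerRows, i ≤ j := by
    rw [mem_lowerRows]
    refine (le_or_gt _ _).imp_right fun h => ⟨h, fun j hj => Fin.le_def.2 ?_⟩
    have := D.mem_lowerRows.1 hj
    omega
  rw [plainFlag_eq]
  unfold uLetter uWord
  cases hD : D.sign
  · refine prod_getD_alternating g .x .yt (D.pairwise_lowerRows.imp fun h => ⟨hp h, hq h⟩)
      (hmem.imp_right fun h => ⟨?_, fun j hj => hp (h.2 j hj)⟩)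
    exact Int.toNat_of_nonpos (neg_nonpos.2 (D.q_nonneg_of_lt_s hD h.1))
  · rw [add_comm, mul_comm]
    refine prod_getD_alternating g .yt .x (D.pairwise_lowerRows.imp fun h => ⟨hq h, hp h⟩)
      (hmem.imp_right fun h => ⟨?_, fun j hj => hq (h.2 j hj)⟩)
    exact Int.toNat_of_nonpos (D.p_nonpos_of_lt_s hD h.1)

end Division

end CompleteTriple

section Chern

open PowerSeries

variable {R : Type*} [CommRing R]

theorem prod_Icc_one_eq_prod_range {M : Type*} [CommMonoid M] (g : ℤ → M) (m : ℤ) :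
    ∏ k ∈ Finset.Icc 1 m, g k = ∏ t ∈ Finset.range m.toNat, g ((t + 1 : ℕ) : ℤ) := by
  rw [Int.Icc_eq_finset_map, Finset.prod_map, add_sub_cancel_right]
  refine Finset.prod_congr rfl fun t _ => congrArg g ?_
  simp [add_comm]

theorem prod_Icc_zero_eq_prod_range {M : Type*} [CommMonoid M] (g : ℤ → M) (m : ℤ) :
    ∏ k ∈ Finset.Icc (m + 1) 0, g k =
      ∏ t ∈ Finset.range (-m).toNat, g (1 - ((t + 1 : ℕ) : ℤ)) := by
  rw [← prod_Icc_one_eq_prod_range fun k => g (1 - k)]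
  refine Finset.prod_equiv (Equiv.subLeft 1) (fun k => ?_) fun k _ => ?_
  · simp only [Finset.mem_Icc, Equiv.subLeft_apply]
    omega
  · simp

theorem chernNum_eq (x y : ℤ → R) (p q : ℤ) :
    chernNum x y p q =
      (∏ t ∈ Finset.range q.toNat, (1 + C (letterValue x y (.y (t + 1))) * X)) *
        ∏ t ∈ Finset.range (-p).toNat, (1 + C (letterValue x y (.xt (t + 1))) * X) := by
  rw [chernNum, prod_Icc_one_eq_prod_range, prod_Icc_zero_eq_prod_range, mul_comm]
  simp only [letterValue, map_neg, neg_mul, sub_eq_add_neg]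

theorem chernDen_eq (x y : ℤ → R) (p q : ℤ) :
    chernDen x y p q =
      (∏ t ∈ Finset.range p.toNat, (1 - C (letterValue x y (.x (t + 1))) * X)) *
        ∏ t ∈ Finset.range (-q).toNat, (1 - C (letterValue x y (.yt (t + 1))) * X) := by
  rw [chernDen, prod_Icc_one_eq_prod_range, prod_Icc_zero_eq_prod_range]
  simp only [letterValue, map_neg, neg_mul, sub_neg_eq_add]

namespace CompleteTriple.Division

variable {n : ℕ} {τ : CompleteTriple n} (D : τ.Division) (x y : ℤ → R)

theorem flagSeries_eq_chern (i : Fin n) :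
    flagSeries (extendZero fun k => letterValue x y (D.uLetter k))
      (extendZero fun l => letterValue x y (D.vLetter l)) (D.plainFlag i) (D.primedFlag i) =
      τ.chern x y i := by
  have hpos (t : ℕ) : (0 : ℤ) < (t + 1 : ℕ) := by positivity
  rw [CompleteTriple.chern, chernSeries, chernNum_eq, chernDen_eq,
    ← D.prod_vLetter fun a => 1 + C (letterValue x y a) * X,
    ← D.prod_uLetter fun a => 1 - C (letterValue x y a) * X, flagSeries,
    prod_Icc_one_eq_prod_range, prod_Icc_one_eq_prod_range]
  simp only [extendZero_of_pos _ (hpos _), Int.toNat_natCast]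

theorem aeval_entryWeight (e : Entry) :
    MvPolynomial.aeval (letterValue x y) (D.entryWeight e) =
      e.weight (fun k => letterValue x y (D.uLetter k))
        fun l => letterValue x y (D.vLetter l) := by
  cases e <;> simp [entryWeight, Entry.weight]

theorem skewSchur_chern_eq_aeval_tableauSum {mu : Fin n → ℤ} (hmu : Antitone mu)
    (hle : mu ≤ τ.shape) :
    skewSchur (τ.chern x y) τ.shape mu =
      MvPolynomial.aeval (letterValue x y) (D.tableauSum mu) := by
  have h := sum_tableaux_eq_skewSchur (fun k => letterValue x y (D.uLetter k))
    (fun l => letterValue x y (D.vLetter l)) τ.l_anti hmu hle D.monotone_plainFlag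
    D.primedFlag_eq_plainFlag_add
  simp only [flagSeries_eq_chern] at h
  simp only [tableauSum, map_sum, map_prod, aeval_entryWeight]
  exact h.symm

end CompleteTriple.Division

end Chern

end Vexillary

theorem mainTheorem5_general {n : ℕ} (τ : Vexillary.CompleteTriple n) :
    Nonempty τ.Division ∧
    ∀ (D : τ.Division) {R : Type*} [CommRing R] (x y : ℤ → R),
      (∀ mu : Fin n → ℤ, Antitone mu → (∀ i, mu i ≤ τ.shape i) →
        Vexillary.skewSchur (τ.chern x y) τ.shape mu =
          MvPolynomial.aeval (Vexillary.letterValue x y) (D.tableauSum mu)) ∧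
      ∀ c : PowerSeries R,
        τ.enriched c x y =
          ∑ mu ∈ Vexillary.subpartitions τ.shape,
            MvPolynomial.aeval (Vexillary.letterValue x y) (D.tableauSum mu) *
              Vexillary.schur (fun _ : Fin n => c) mu := by
  refine ⟨τ.nonempty_division, fun D R _ x y =>
    ⟨fun mu hmu hle => D.skewSchur_chern_eq_aeval_tableauSum x y hmu hle, fun c => ?_⟩⟩
  refine (Vexillary.schur_mul (τ.chern x y) c τ.l_anti).trans (Finset.sum_congr rfl ?_)
  intro mu hmu
  obtain ⟨hmem, hanti⟩ := Finset.mem_filter.1 hmu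
  have hle : mu ≤ τ.shape := fun i => (Finset.mem_Icc.1 (Fintype.mem_piFinset.1 hmem i)).2
  exact congrArg (· * _) (D.skewSchur_chern_eq_aeval_tableauSum x y hanti hle)

theorem mainTheorem5 {n : ℕ} (τ : Vexillary.CompleteTriple n) :
    Nonempty τ.Division ∧
    ∀ (D : τ.Division) {R : Type*} [CommRing R] (x y : ℤ → R),
      (∀ mu : Fin n → ℤ, Antitone mu → (∀ i, mu i ≤ τ.shape i) →
        Vexillary.skewSchur (τ.chern x y) τ.shape mu =
          MvPolynomial.aeval (Vexillary.letterValue x y) (D.tableauSum mu)) ∧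
      ∀ c : PowerSeries R, PowerSeries.constantCoeff c = 1 →
        τ.enriched c x y =
          ∑ mu ∈ Vexillary.subpartitions τ.shape,
            MvPolynomial.aeval (Vexillary.letterValue x y) (D.tableauSum mu) *
              Vexillary.schur (fun _ : Fin n => c) mu := by
  obtain ⟨hdivision, hformula⟩ := mainTheorem5_general τ
  exact ⟨hdivision, fun D _ _ x y => (hformula D x y).imp_right fun h c _ => h c⟩
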